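/- **Setting.** Let $E$ be a separable infinite-dimensional complex Banach space, let $N,n\ge 1$ be integers, and let $A_1,\dots,A_N$ be linear operators in $E$ such that $iA_1,\dots,iA_N$ are commuting generators of bounded $C_0$-groups on $E$ (that is, the groups commute). For a multi-index $\eta\in\mathbb N_0^N$ put $A^\eta:=A_1^{\eta_1}\cdots A_N^{\eta_N}$ with its natural domain, and for a complex polynomial $p(\xi)=\sum_\eta c_\eta\xi^\eta$ in $N$ variables put $p(A):=\sum_{c_\eta\ne0}c_\eta A^\eta$ with domain $\bigcap_{c_\eta\neq 0}D(A^\eta)$. Let $p_0,\dots,p_{n-1}$ be complex polynomials in $N$ variables and write $\mathcal A_l:=p_l(A)$, $0\le l\le n-1$. Consider $$(ACP_n):\quad u^{(n)}(t)+\mathcal A_{n-1}u^{(n-1)}(t)+\cdots+\mathcal A_1u'(t)+\mathcal A_0u(t)=0\ (t\ge0),\qquad u^{(k)}(0)=u_k\ (0\le k\le n-1),$$ and the companion operator matrix $\mathbf P$ on $E^n$, with domain $D(\mathcal A_0)\times\cdots\times D(\mathcal A_{n-1})$, $$\mathbf P(x_1,\dots,x_n)=\Bigl(x_2,\dots,x_n,\,-\sum_{l=0}^{n-1}\mathcal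 A_lx_{l+1}\Bigr).$$ A strong solution of $(ACP_n)$ is an $n$-times continuously differentiable function $u:[0,\infty)\to E$ such that $u^{(i)}(t)\in D(\mathcal A_i)$ for all $t\ge 0$, each $t\mapsto \mathcal A_iu^{(i)}(t)$ $(0\le i\le n-1)$ is continuous on $[0,\infty)$, and the equation and the initial conditions hold. **Definition.** Let $\emptyset\ne W\subseteq\{0,\dots,n-1\}$, let $\tilde E$ be a linear subspace of $E^n$ (coordinates numbered $0,\dots,n-1$) and let $\mathcal E=(E_i)_{i\in W}$ be a tuple of linear subspaces of $E$. The problem $(ACP_n)$ is $(W,\tilde E,\mathcal E)$-frequently hypercyclic if there is a strong solution $u$ of $(ACP_n)$ with initial values $(u_0,\dots,u_{n-1})\in\tilde E$ such that, for every tuple $(V_i)_{i\in W}$ of open subsets of $E$ for which some $y\in\tilde E$ satisfies $y_i\in V_i\cap E_i$ for all $i\in W$, the set $$S:=\bigcap_{i\in W}\{t\ge0:\ u^{(i)}(t)\in V_i\cap E_i\}$$ has positive lower density, i.e. $\liminf_{t\to\infty} m(S\cap[0,t])/t>0$, where $m$ is Lebesgue measure. **Theorem.** Let $(F_j)_{j\in\Gamma}$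 be a family of twice continuously differentiable maps $F_j:I_j\to E^n$, where each $I_j$ is an interval in $\mathbb R$ with more than one point, such that $F_j(t)\in D(\mathbf P)$ and $\mathbf PF_j(t)=it\,F_j(t)$ for all $t\in I_j$, $j\in\Gamma$. Set $\tilde E:=\overline{\operatorname{span}\{F_j(t):j\in\Gamma,\ t\in I_j\}}\subseteq E^n$. Then $(ACP_n)$ is $(\{0,1,\dots,n-1\},\tilde E,\mathcal E)$-frequently hypercyclic with $\mathcal E:=(\pi_1(\tilde E),\dots,\pi_n(\tilde E))$, where $\pi_j:E^n\to E$ is the $j$-th projection. -/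

import Mathlib

open Set Filter Topology MeasureTheory

noncomputable section

namespace HigherOrderACP

section Operators

variable {E : Type*} [NormedAddCommGroup E] [NormedSpace ℂ E]

/-- The everywhere defined identity, as an unbounded operator. -/
def idOp : E →ₗ.[ℂ] E := (LinearMap.id : E →ₗ[ℂ] E).toPMap ⊤

/-- The product `g f` of two unbounded operators, on its natural domain
`{x ∈ D(f) : f x ∈ D(g)}`. -/
def mulOp (g f : E →ₗ.[ℂ] E) : E →ₗ.[ℂ] E :=
  g.comp (f.domRestrict ((g.domain.comap f.toFun).map f.domain.subtype)) (by
    rintro ⟨x, ⟨⟨y, hy, rfl⟩, hx⟩⟩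
    exact hy)

/-- The powers `B ^ k` of an unbounded operator, on their natural domains. -/
def powOp (B : E →ₗ.[ℂ] E) : ℕ → (E →ₗ.[ℂ] E)
  | 0 => idOp
  | k + 1 => mulOp B (powOp B k)

/-- `A ^ η = A₁ ^ η₁ ⋯ A_N ^ η_N` (the last factor acts first), on its natural domain. -/
def monomialOp {N : ℕ} (A : Fin N → (E →ₗ.[ℂ] E)) (η : Fin N →₀ ℕ) : E →ₗ.[ℂ] E :=
  (List.ofFn fun j => powOp (A j) (η j)).foldr mulOp idOp

/-- `p(A) = ∑ c_η A ^ η` for `p = ∑ c_η ξ ^ η`; the sum runs over the `η` with `c_η ≠ 0`, and its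
domain is the intersection of the domains of these `A ^ η`. -/
def polyOp {N : ℕ} (A : Fin N → (E →ₗ.[ℂ] E)) (p : MvPolynomial (Fin N) ℂ) : E →ₗ.[ℂ] E :=
  ∑ η ∈ p.support, p.coeff η • monomialOp A η

/-- The companion operator matrix on `E ^ n`: the domain is `D(A₀) × ⋯ × D(A_{n-1})`, and
`(x₀, …, x_{n-1})` is sent to `(x₁, …, x_{n-1}, - A₀ x₀ - ⋯ - A_{n-1} x_{n-1})`. -/
def companionOp {n : ℕ} (A : Fin n → (E →ₗ.[ℂ] E)) : (Fin n → E) →ₗ.[ℂ] (Fin n → E) where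
  domain := ⨅ l, (A l).domain.comap (LinearMap.proj l)
  toFun := LinearMap.pi fun i =>
    if h : (i : ℕ) + 1 < n then
      (LinearMap.proj (⟨i + 1, h⟩ : Fin n) : (Fin n → E) →ₗ[ℂ] E).comp (Submodule.subtype _)
    else
      - ∑ l, (A l).toFun.comp
          ((LinearMap.proj l : (Fin n → E) →ₗ[ℂ] E).restrict
            (fun _ hx => (Submodule.mem_iInf _).1 hx l))

/-- `T` is a bounded `C₀`-group of bounded linear operators on `E`. -/
structure IsBoundedC0Group (T : ℝ → E →L[ℂ] E) : Prop where
  map_zero : T 0 = 1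
  map_add : ∀ s t, T (s + t) = T s * T t
  continuous_orbit : ∀ x, Continuous fun t => T t x
  bounded : ∃ M : ℝ, ∀ t, ‖T t‖ ≤ M

/-- `B` is the generator of the group `T`: `x ∈ D(B)` and `B x = y` precisely when the orbit
`t ↦ T t x` is differentiable at `0` with derivative `y`. -/
def IsGroupGenerator (B : E →ₗ.[ℂ] E) (T : ℝ → E →L[ℂ] E) : Prop :=
  ∀ x y : E, (x, y) ∈ B.graph ↔ HasDerivAt (fun t : ℝ => T t x) y 0

/-- The lower density `liminf_{t → ∞} m(S ∩ [0, t]) / t`. -/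
def lowerDensity (S : Set ℝ) : ENNReal :=
  liminf (fun t : ℝ => volume (S ∩ Icc 0 t) / ENNReal.ofReal t) atTop

/-- The `k`-th derivative on `[0, ∞)`, one-sided at `0`. -/
def halfLineDeriv (k : ℕ) (u : ℝ → E) (t : ℝ) : E := iteratedDerivWithin k u (Ici 0) t

/-- `u` is a strong solution on `[0, ∞)` of
`u⁽ⁿ⁾(t) + A_{n-1} u⁽ⁿ⁻¹⁾(t) + ⋯ + A₀ u(t) = 0`, `u⁽ᵏ⁾(0) = x_k` for `k < n`:
it is `n` times continuously differentiable, each `u⁽ⁱ⁾(t)` lies in `D(A_i)`, each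
`v_i(t) = A_i u⁽ⁱ⁾(t)` is continuous in `t`, and the equation and the initial conditions hold. -/
def IsStrongSolution {n : ℕ} (A : Fin n → (E →ₗ.[ℂ] E)) (x : Fin n → E) (u : ℝ → E) : Prop :=
  ContDiffOn ℝ n u (Ici 0) ∧
  (∃ v : Fin n → ℝ → E,
    (∀ i, ContinuousOn (v i) (Ici 0)) ∧
    (∀ i, ∀ t ∈ Ici (0 : ℝ), (halfLineDeriv (i : ℕ) u t, v i t) ∈ (A i).graph) ∧
    (∀ t ∈ Ici (0 : ℝ), halfLineDeriv n u t + ∑ i, v i t = 0)) ∧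
  ∀ k : Fin n, halfLineDeriv (k : ℕ) u 0 = x k

/-- `(W, Ẽ, ℰ)`-frequent hypercyclicity of the Cauchy problem of order `n` with operators `A`:
some strong solution with initial values in `Ẽ` is such that, for each tuple of open sets
`V_i` (`i ∈ W`) that is met by the subspace (some `y ∈ Ẽ` has `y_i ∈ V_i ∩ E_i` for all `i ∈ W`),
the set of times `t` at which `u⁽ⁱ⁾(t) ∈ V_i ∩ E_i` simultaneously for all `i ∈ W` has positive
lower density. If `Ẽ` is the whole of `E ^ n` and every `E_i` is `E`, these are all the
tuples of non-empty open sets. -/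
def IsFreqHypercyclicACP {n : ℕ} (A : Fin n → (E →ₗ.[ℂ] E)) (W : Set (Fin n))
    (Et : Submodule ℂ (Fin n → E)) (Es : W → Submodule ℂ E) : Prop :=
  W.Nonempty ∧
  ∃ (x : Fin n → E) (u : ℝ → E), x ∈ Et ∧ IsStrongSolution A x u ∧
    ∀ V : W → Set E, (∀ i, IsOpen (V i)) →
      (∃ y ∈ Et, ∀ i : W, y i ∈ V i ∩ (Es i : Set E)) →
      0 < lowerDensity {t : ℝ | 0 ≤ t ∧
        ∀ i : W, halfLineDeriv ((i : Fin n) : ℕ) u t ∈ V i ∩ (Es i : Set E)}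

end Operators

end HigherOrderACP

end

/-!
Every eigenvector `F_j(s)` of the companion matrix gives the solution `e ^ (i t s) F_j(s)`, and a
frequently hypercyclic solution is built as a series of finite combinations of these.

**The space.** The operators `p_l(A)` on their natural domains need not be closed, but the graph
of each is the image of a closed subspace of some `E × Y l`, where the coordinates in `Y l` record
all intermediate values in the evaluation of the monomials (`HasClosedLift`; the generators
themselves are closed). Hence a locally uniform limit of combinations of the `e ^ (i t s) F_j(s)` is
a strong solution as soon as it converges together with these coordinates, that is, in
`E ^ n × ∏ Y l`. There the lifted eigenvectors `g` need not depend continuously on `s`. However,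
the space is second countable, so after discarding countably many frequencies `s` each pair
`(s, g)` is a condensation point of the others (`exists_isCondensed`); since the `F_j` are
continuous, the remaining eigenvectors still span a dense subspace of `Ẽ`.

**The blocks.** Suppose a finite sum `U` with rationally independent frequencies is given, and a
target `y` in the span of the `g`. Near an index `i` choose `m` pairs of new frequencies,
successively and each far closer together than the preceding ones, and add up the differences
`(e ^ (i t α) - e ^ (i t β)) / (2 m)`. Over any interval `[0, T]` at most one of the pairs is
neither still in phase nor already averaged out, so by orthogonality the mean square of the sum is
`O(1 / m)` (`exists_flat_scalar`): the block is small for most of the time, at every time scale.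
By Kronecker's theorem (`kronecker_density`) the phases are nevertheless, with positive lower
density, such that all terms of the block add up to about `g_i` while the old frequencies are back
at phase `1`. Combining such blocks, `U` plus the block comes close to `y` with positive lower
density (`IsCondensed.exists_step`).

**The series.** Repeating this for a dense sequence of targets, with exceptional sets of times so
sparse that they spare half of each of the earlier sets of visits, yields a locally uniformly
convergent series whose sum visits every ball about a point of the span with positive lower density
(`IsCondensed.exists_frequently_visiting`).
-/

noncomputable section

namespace HigherOrderACP

universe u

/-! ### Characters, mean values and Kronecker's theorem -/

/-- The character `t ↦ e ^ (i a t)` of the real line. -/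
def phase (a t : ℝ) : ℂ := Complex.exp ((a * t : ℝ) * Complex.I)

@[simp] lemma norm_phase (a t : ℝ) : ‖phase a t‖ = 1 := Complex.norm_exp_ofReal_mul_I _

@[simp] lemma phase_zero_right (a : ℝ) : phase a 0 = 1 := by simp [phase]

@[simp] lemma phase_zero_left (t : ℝ) : phase 0 t = 1 := by simp [phase]

lemma phase_add (a b t : ℝ) : phase (a + b) t = phase a t * phase b t := by
  simp only [phase, ← Complex.exp_add]; congr 1; push_cast; ring

lemma phase_conj (a t : ℝ) : (starRingEnd ℂ) (phase a t) = phase (-a) t := by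
  simp only [phase, ← Complex.exp_conj]; simp

lemma phase_zpow (a t : ℝ) (k : ℤ) : phase a t ^ k = phase (k * a) t := by
  simp only [phase, ← Complex.exp_int_mul]; congr 1; push_cast; ring

lemma hasDerivAt_phase (a t : ℝ) : HasDerivAt (phase a) (Complex.I * a * phase a t) t := by
  have h : HasDerivAt (fun t : ℝ => ((a * t : ℝ) : ℂ) * Complex.I) (a * Complex.I) t := by
    have := ((hasDerivAt_id t).const_mul a).ofReal_comp.mul_const Complex.I
    simpa using this
  have h2 : HasDerivAt (phase a) (phase a t * (a * Complex.I)) t := h.cexp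
  convert h2 using 1; ring

@[fun_prop] lemma continuous_phase (a : ℝ) : Continuous (phase a) :=
  continuous_iff_continuousAt.2 fun t => (hasDerivAt_phase a t).continuousAt

lemma norm_phase_sub_phase_le (a b t : ℝ) : ‖phase a t - phase b t‖ ≤ |a - b| * |t| := by
  have h : phase a t - phase b t =
      phase b t * (Complex.exp (Complex.I * ((a - b) * t : ℝ)) - 1) := by
    have : a = b + (a - b) := by ring
    conv_lhs => rw [this, phase_add]
    simp only [phase, mul_comm Complex.I]; ring
  rw [h, norm_mul, norm_phase, one_mul, ← abs_mul]
  exact Real.norm_exp_I_mul_ofReal_sub_one_le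

/-- The function `f` has mean value `m` along `[0, ∞)`: `(1 / T) ∫₀ᵀ f → m` as `T → ∞`. -/
def HasMean (f : ℝ → ℂ) (m : ℂ) : Prop :=
  Tendsto (fun T : ℝ => (T : ℂ)⁻¹ * ∫ t in (0 : ℝ)..T, f t) atTop (𝓝 m)

lemma HasMean.const_mul {f : ℝ → ℂ} {m : ℂ} (h : HasMean f m) (a : ℂ) :
    HasMean (fun t => a * f t) (a * m) := by
  refine (Tendsto.const_mul a h).congr fun T => ?_
  rw [intervalIntegral.integral_const_mul]; ring

lemma HasMean.sum {κ : Type*} (s : Finset κ) {f : κ → ℝ → ℂ} {m : κ → ℂ}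
    (hf : ∀ k ∈ s, Continuous (f k)) (h : ∀ k ∈ s, HasMean (f k) (m k)) :
    HasMean (fun t => ∑ k ∈ s, f k t) (∑ k ∈ s, m k) := by
  refine (tendsto_finsetSum s h).congr fun T => ?_
  rw [intervalIntegral.integral_finsetSum fun k hk => (hf k hk).intervalIntegrable _ _,
    Finset.mul_sum]

lemma hasMean_one : HasMean (fun _ => 1) 1 := by
  refine tendsto_const_nhds.congr' ?_
  filter_upwards [eventually_gt_atTop 0] with T hT
  have : (T : ℂ) ≠ 0 := by exact_mod_cast hT.ne'
  simp [this]

lemma hasMean_phase {a : ℝ} (ha : a ≠ 0) : HasMean (phase a) 0 := by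
  have hc : Complex.I * (a : ℂ) ≠ 0 := mul_ne_zero Complex.I_ne_zero (by exact_mod_cast ha)
  have hint : ∀ T : ℝ, ∫ t in (0 : ℝ)..T, phase a t = (Complex.I * a)⁻¹ * (phase a T - 1) := by
    intro T
    have := intervalIntegral.integral_eq_sub_of_hasDerivAt (a := 0) (b := T)
      (fun t _ => hasDerivAt_phase a t)
      ((continuous_phase a).const_mul (Complex.I * a) |>.intervalIntegrable _ _)
    rw [intervalIntegral.integral_const_mul, phase_zero_right] at this
    rw [← this, inv_mul_cancel_left₀ hc]
  refine squeeze_zero_norm' (a := fun T : ℝ => (‖(Complex.I * (a : ℂ))⁻¹‖ * 2) * T⁻¹) ?_ ?_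
  · filter_upwards [eventually_gt_atTop 0] with T hT
    rw [hint, norm_mul, norm_mul, norm_inv, Complex.norm_real, Real.norm_of_nonneg hT.le, mul_comm]
    gcongr
    exact (norm_sub_le _ _).trans (by simp; norm_num)
  · simpa using tendsto_inv_atTop_zero.const_mul (‖(Complex.I * (a : ℂ))⁻¹‖ * 2)

lemma hasMean_phase_ite (a : ℝ) : HasMean (phase a) (if a = 0 then 1 else 0) := by
  split_ifs with h
  · subst h; simpa [funext phase_zero_left] using hasMean_one
  · exact hasMean_phase h

/-- Parseval's identity for exponential polynomials with distinct frequencies. -/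
lemma hasMean_norm_sq {ι : Type*} (s : Finset ι) (lam : ι → ℝ) (hs : Set.InjOn lam s)
    (c : ι → ℂ) :
    HasMean (fun t => ((‖∑ i ∈ s, c i * phase (lam i) t‖ ^ 2 : ℝ) : ℂ))
      ((∑ i ∈ s, ‖c i‖ ^ 2 : ℝ) : ℂ) := by
  classical
  have h1 : (fun t => ((‖∑ i ∈ s, c i * phase (lam i) t‖ ^ 2 : ℝ) : ℂ)) = fun t =>
      ∑ i ∈ s, ∑ j ∈ s, c i * (starRingEnd ℂ) (c j) * phase (lam i + -lam j) t := by
    ext t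
    rw [Complex.ofReal_pow, ← Complex.mul_conj', map_sum, Finset.sum_mul_sum]
    refine Finset.sum_congr rfl fun i _ => Finset.sum_congr rfl fun j _ => ?_
    rw [map_mul, phase_conj, phase_add]; ring
  have h2 : ((∑ i ∈ s, ‖c i‖ ^ 2 : ℝ) : ℂ) = ∑ i ∈ s, ∑ j ∈ s,
      c i * (starRingEnd ℂ) (c j) * (if lam i + -lam j = 0 then 1 else 0) := by
    rw [Complex.ofReal_sum]
    refine Finset.sum_congr rfl fun i hi => ?_
    rw [Finset.sum_eq_single_of_mem i hi]
    · simp [Complex.mul_conj']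
    · intro j hj hij
      rw [if_neg, mul_zero]
      intro h
      exact hij (hs hj hi (by linarith))
  rw [h1, h2]
  refine HasMean.sum _ (fun i _ => by fun_prop) fun i _ => HasMean.sum _ (fun i _ => by fun_prop)
    fun j _ => (hasMean_phase_ite _).const_mul _

/-- Asymptotic independence of characters with rationally independent frequencies: the mean
of a product of exponential polynomials, one in each of the frequencies, is the product of
their means. The extra factor `phase a` carries the induction. -/
lemma hasMean_phase_mul_prod {ι : Type*} (lam : ι → ℝ) (b : ι → ℕ → ℂ) (q : ℕ) (K : Finset ℕ)
    (hK : q ∈ K) (s : Finset ι) (hs : LinearIndepOn ℚ lam (s : Set ι)) :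
    ∀ a : ℝ, (a = 0 ∨ a ∉ Submodule.span ℚ (lam '' s)) →
      HasMean (fun t => phase a t *
          ∏ i ∈ s, ∑ k ∈ K, b i k * phase (((k : ℤ) - q : ℤ) * lam i) t)
        (if a = 0 then ∏ i ∈ s, b i q else 0) := by
  classical
  induction s using Finset.induction_on with
  | empty => intro a _; simpa using hasMean_phase_ite a
  | insert j s hj ih =>
    intro a ha
    rw [Finset.coe_insert, linearIndepOn_insert (by simpa using hj)] at hs
    have hsub : Submodule.span ℚ (lam '' s) ≤ Submodule.span ℚ (lam '' (insert j s : Finset ι)) :=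
      Submodule.span_mono (image_mono (by simp))
    have hjmem : lam j ∈ Submodule.span ℚ (lam '' (insert j s : Finset ι)) :=
      Submodule.subset_span ⟨j, by simp, rfl⟩
    have hsmul : ∀ k : ℤ, (k : ℝ) * lam j = (k : ℚ) • lam j := fun k => by
      rw [Rat.smul_def]; simp
    have key : ∀ k : ℤ, (a + k * lam j = 0 ∨ a + k * lam j ∉ Submodule.span ℚ (lam '' s)) ∧
        (a + k * lam j = 0 ↔ a = 0 ∧ k = 0) := by
      intro k
      rcases ha with rfl | ha
      · rcases eq_or_ne k 0 with rfl | hk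
        · simp
        · have hnot : 0 + (k : ℝ) * lam j ∉ Submodule.span ℚ (lam '' s) := by
            rw [zero_add, hsmul, Submodule.smul_mem_iff _ (by exact_mod_cast hk)]
            exact hs.2
          have hne : 0 + (k : ℝ) * lam j ≠ 0 := fun h => hnot (by rw [h]; exact zero_mem _)
          exact ⟨Or.inr hnot, ⟨fun h => absurd h hne, fun h => absurd h.2 hk⟩⟩
      · have hnot : a + (k : ℝ) * lam j ∉ Submodule.span ℚ (lam '' (insert j s : Finset ι)) := by
          rw [hsmul]
          intro h
          exact ha ((Submodule.add_mem_iff_left _ (Submodule.smul_mem _ _ hjmem)).1 h)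
        have ha0 : a ≠ 0 := fun h => ha (by rw [h]; exact zero_mem _)
        have hne : a + (k : ℝ) * lam j ≠ 0 := fun h => hnot (by rw [h]; exact zero_mem _)
        exact ⟨Or.inr fun h => hnot (hsub h), ⟨fun h => absurd h hne, fun h => absurd h.1 ha0⟩⟩
    have h1 : (fun t => phase a t *
        ∏ i ∈ insert j s, ∑ k ∈ K, b i k * phase (((k : ℤ) - q : ℤ) * lam i) t) = fun t =>
        ∑ k ∈ K, b j k * (phase (a + ((k : ℤ) - q : ℤ) * lam j) t *
          ∏ i ∈ s, ∑ k ∈ K, b i k * phase (((k : ℤ) - q : ℤ) * lam i) t) := by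
      ext t
      rw [Finset.prod_insert hj, Finset.sum_mul, Finset.mul_sum]
      refine Finset.sum_congr rfl fun k _ => ?_
      rw [phase_add]; ring
    have h2 : (if a = 0 then ∏ i ∈ insert j s, b i q else 0) = ∑ k ∈ K,
        b j k * (if a + ((k : ℤ) - q : ℤ) * lam j = 0 then ∏ i ∈ s, b i q else 0) := by
      rw [Finset.sum_eq_single_of_mem q hK, Finset.prod_insert hj]
      · simp
      · intro k _ hk
        rw [if_neg (fun h => hk (by have := ((key _).2.1 h).2; omega)), mul_zero]
    rw [h1, h2]
    exact HasMean.sum _ (fun k _ => by fun_prop) fun k _ => (ih hs.1 _ (key _).1).const_mul _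

/-- The kernel `|(1 + w) / 2| ^ (2 q)`, which on the unit circle peaks at `w = 1`, as an
exponential polynomial. -/
lemma norm_one_add_div_two_pow (q : ℕ) {w : ℂ} (hw : ‖w‖ = 1) :
    ((‖(1 + w) / 2‖ ^ (2 * q) : ℝ) : ℂ) =
      ∑ k ∈ Finset.range (2 * q + 1), ((2 * q).choose k : ℂ) / 4 ^ q * w ^ ((k : ℤ) - q) := by
  have hw0 : w ≠ 0 := by rintro rfl; simp at hw
  have hconj : (starRingEnd ℂ) w = w⁻¹ := by rw [Complex.inv_eq_conj hw]
  have h1 : ((‖(1 + w) / 2‖ ^ (2 * q) : ℝ) : ℂ) = (((1 + w) ^ 2 * w⁻¹) / 4) ^ q := by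
    rw [pow_mul, Complex.ofReal_pow, Complex.ofReal_pow, ← Complex.mul_conj']
    congr 1
    rw [map_div₀, map_add, hconj, map_one, Complex.conj_ofNat]
    field_simp; ring
  rw [h1, div_pow, mul_pow, ← pow_mul, add_comm (1 : ℂ) w, add_pow, Finset.sum_mul, Finset.sum_div]
  refine Finset.sum_congr rfl fun k _ => ?_
  rw [zpow_sub₀ hw0]
  simp; ring

/-- Kronecker's theorem with positive lower density: if the frequencies are rationally
independent, the times at which all the characters are close to prescribed unimodular numbers
have positive lower density. -/
lemma kronecker_density {ι : Type*} (lam : ι → ℝ) (s : Finset ι)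
    (hs : LinearIndepOn ℚ lam (s : Set ι)) (θ : ι → ℂ) (hθ : ∀ i, ‖θ i‖ = 1) {ε : ℝ}
    (hε : 0 < ε) :
    ∃ d > 0, ∀ᶠ T : ℝ in atTop, ENNReal.ofReal (d * T) ≤
      volume ({t | ∀ i ∈ s, ‖phase (lam i) t - θ i‖ < ε} ∩ Icc 0 T) := by
  classical
  wlog hε1 : ε ≤ 1 generalizing ε
  · obtain ⟨d, hd, h⟩ := this one_pos le_rfl
    refine ⟨d, hd, h.mono fun T hT => hT.trans (measure_mono ?_)⟩
    exact inter_subset_inter_left _ fun t ht i hi => (ht i hi).trans_le (not_le.1 hε1).le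
  set ρ : ℝ := 1 - ε ^ 2 / 4 with hρ
  have hρ0 : 0 ≤ ρ := by nlinarith
  have hρ1 : ρ < 1 := by nlinarith
  -- the mean `(C(2q, q) / 4 ^ q) ^ |s|` of the kernel decays polynomially in `q`, whereas its
  -- values off the target decay exponentially
  obtain ⟨q, hq0, hq⟩ : ∃ q : ℕ, 0 < q ∧ ρ ^ q < ((q.centralBinom : ℝ) / 4 ^ q) ^ s.card := by
    have h1 := (tendsto_pow_const_mul_const_pow_of_abs_lt_one s.card
      (abs_lt.2 ⟨by linarith, hρ1⟩)).const_mul ((2 : ℝ) ^ s.card)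
    rw [mul_zero] at h1
    obtain ⟨q, h2, hq⟩ := ((h1.eventually (gt_mem_nhds one_pos)).and
      (eventually_gt_atTop 0)).exists
    refine ⟨q, hq, ?_⟩
    have hq' : (0 : ℝ) < q := by exact_mod_cast hq
    have h3 : ((2 * q : ℝ)⁻¹) ^ s.card ≤ ((q.centralBinom : ℝ) / 4 ^ q) ^ s.card := by
      gcongr
      rw [inv_eq_one_div, div_le_div_iff₀ (by positivity) (by positivity), one_mul]
      have := Nat.four_pow_le_two_mul_self_mul_centralBinom q hq
      have h4 : ((4 ^ q : ℕ) : ℝ) ≤ ((2 * q * q.centralBinom : ℕ) : ℝ) := by exact_mod_cast this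
      push_cast at h4; linarith
    refine lt_of_lt_of_le ?_ h3
    rw [inv_pow, inv_eq_one_div, lt_div_iff₀ (by positivity), mul_pow]
    linarith
  set μ : ℝ := ((q.centralBinom : ℝ) / 4 ^ q) ^ s.card with hμ
  set k : ℝ → ℝ := fun t => ∏ i ∈ s, ‖(1 + (starRingEnd ℂ) (θ i) * phase (lam i) t) / 2‖ ^ (2 * q)
    with hk
  have hkc : Continuous k := by fun_prop
  have hnorm : ∀ i t, ‖(starRingEnd ℂ) (θ i) * phase (lam i) t‖ = 1 := fun i t => by
    simp [hθ]
  have hmean : HasMean (fun t => (k t : ℂ)) μ := by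
    have := hasMean_phase_mul_prod lam
      (fun i k => ((2 * q).choose k : ℂ) / 4 ^ q * (starRingEnd ℂ) (θ i) ^ ((k : ℤ) - q)) q
      (Finset.range (2 * q + 1)) (by simp; omega) s hs 0 (Or.inl rfl)
    convert this using 1
    · ext t
      rw [hk, Complex.ofReal_prod, phase_zero_left, one_mul]
      refine Finset.prod_congr rfl fun i _ => ?_
      rw [norm_one_add_div_two_pow q (hnorm i t)]
      refine Finset.sum_congr rfl fun j _ => ?_
      rw [mul_zpow, phase_zpow, mul_assoc]
    · simp [hμ, Nat.centralBinom, div_pow]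
  have hreal : Tendsto (fun T : ℝ => T⁻¹ * ∫ t in (0 : ℝ)..T, k t) atTop (𝓝 μ) := by
    have := (Complex.continuous_re.tendsto _).comp hmean
    refine this.congr fun T => ?_
    simp only [Function.comp_apply]
    rw [intervalIntegral.integral_ofReal, ← Complex.ofReal_inv, ← Complex.ofReal_mul,
      Complex.ofReal_re]
  set S : Set ℝ := {t | ∀ i ∈ s, ‖phase (lam i) t - θ i‖ < ε} with hS
  have hSm : MeasurableSet S := by
    have : S = ⋂ i ∈ s, {t | ‖phase (lam i) t - θ i‖ < ε} := by ext; simp [hS]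
    rw [this]
    exact s.measurableSet_biInter fun i _ => measurableSet_lt (by fun_prop) measurable_const
  have hk1 : ∀ i t, ‖(1 + (starRingEnd ℂ) (θ i) * phase (lam i) t) / 2‖ ≤ 1 := fun i t => by
    rw [norm_div, Complex.norm_ofNat, div_le_one two_pos]
    refine (norm_add_le _ _).trans ?_
    rw [hnorm, norm_one]; norm_num
  have hkle1 : ∀ t, k t ≤ 1 := fun t =>
    Finset.prod_le_one (fun _ _ => by positivity) fun i _ => pow_le_one₀ (norm_nonneg _) (hk1 i t)
  have hkoff : ∀ t ∉ S, k t ≤ ρ ^ q := by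
    intro t ht
    simp only [hS, mem_ofPred_eq, not_forall, not_lt] at ht
    obtain ⟨i, hi, ht⟩ := ht
    simp only [hk]
    rw [← Finset.mul_prod_erase s _ hi]
    refine (mul_le_of_le_one_right (by positivity) (Finset.prod_le_one (fun _ _ => by positivity)
      fun i _ => pow_le_one₀ (norm_nonneg _) (hk1 i t))).trans ?_
    rw [pow_mul]
    refine pow_le_pow_left₀ (by positivity) ?_ q
    have h5 : ‖phase (lam i) t - θ i‖ = ‖1 - (starRingEnd ℂ) (θ i) * phase (lam i) t‖ := by
      have h6 : θ i * (1 - (starRingEnd ℂ) (θ i) * phase (lam i) t) = θ i - phase (lam i) t := by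
        rw [mul_sub, ← mul_assoc, Complex.mul_conj', hθ]; simp
      rw [norm_sub_rev, ← h6, norm_mul, hθ, one_mul]
    rw [h5] at ht
    have h7 := parallelogram_law_with_norm ℝ (1 : ℂ) ((starRingEnd ℂ) (θ i) * phase (lam i) t)
    rw [hnorm, norm_one] at h7
    rw [norm_div, Complex.norm_ofNat, hρ]
    nlinarith
  have hint : ∀ T : ℝ, 0 ≤ T →
      ∫ t in (0 : ℝ)..T, k t ≤ volume.real (S ∩ Icc 0 T) + ρ ^ q * T := by
    intro T hT
    have hfin : volume (Ioc (0 : ℝ) T) ≠ ⊤ := by simp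
    have h8 : ∀ t, k t ≤ S.indicator 1 t + ρ ^ q := by
      intro t
      by_cases ht : t ∈ S
      · simpa [ht] using (hkle1 t).trans (le_add_of_nonneg_right (pow_nonneg hρ0 q))
      · simpa [ht] using hkoff t ht
    rw [intervalIntegral.integral_of_le hT]
    have hi : IntegrableOn (S.indicator (1 : ℝ → ℝ)) (Ioc 0 T) :=
      (integrableOn_const (C := (1 : ℝ)) hfin).indicator hSm
    have hi2 : IntegrableOn (fun _ : ℝ => ρ ^ q) (Ioc 0 T) := integrableOn_const hfin
    calc ∫ t in Ioc 0 T, k t ≤ ∫ t in Ioc 0 T, (S.indicator 1 t + ρ ^ q) :=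
          integral_mono (hkc.integrableOn_Ioc) (hi.add hi2) h8
      _ = volume.real (S ∩ Ioc 0 T) + ρ ^ q * T := by
          rw [integral_add hi hi2, integral_indicator_one hSm, measureReal_restrict_apply hSm]
          simp [hT, mul_comm]
      _ ≤ _ := by
          gcongr
          · exact ((measure_mono inter_subset_right).trans_lt measure_Icc_lt_top).ne
          · exact Ioc_subset_Icc_self
  refine ⟨(μ - ρ ^ q) / 2, by linarith, ?_⟩
  filter_upwards [hreal.eventually (lt_mem_nhds (show (μ + ρ ^ q) / 2 < μ by linarith)),
    eventually_gt_atTop 0] with T hT hT0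
  have h9 := hint T hT0.le
  rw [← ENNReal.ofReal_toReal (a := volume (S ∩ Icc 0 T))
    ((measure_mono inter_subset_right).trans_lt measure_Icc_lt_top).ne]
  refine ENNReal.ofReal_le_ofReal ?_
  rw [inv_mul_eq_div, lt_div_iff₀ hT0] at hT
  change _ ≤ volume.real _
  linarith

/-! ### Exponential polynomials that are small most of the time -/

/-- The exponential polynomial `t ↦ ∑ c_i e ^ (i λ_i t) g_i`. -/
def trigPoly {ι X : Type*} [AddCommGroup X] [Module ℂ X] (lam : ι → ℝ) (g : ι → X) (t : ℝ) :
    (ι →₀ ℂ) →ₗ[ℂ] X :=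
  Finsupp.linearCombination ℂ fun i => phase (lam i) t • g i

section TrigPoly

variable {ι X : Type*} [NormedAddCommGroup X] [NormedSpace ℂ X] {lam : ι → ℝ} {g : ι → X}

lemma trigPoly_apply (c : ι →₀ ℂ) (t : ℝ) :
    trigPoly lam g t c = ∑ i ∈ c.support, c i • phase (lam i) t • g i := by
  simp [trigPoly, Finsupp.linearCombination_apply, Finsupp.sum]

lemma trigPoly_one_apply (c : ι →₀ ℂ) (t : ℝ) :
    trigPoly lam (fun _ => (1 : ℂ)) t c = ∑ i ∈ c.support, c i * phase (lam i) t := by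
  simp [trigPoly_apply]

@[fun_prop] lemma continuous_trigPoly (c : ι →₀ ℂ) : Continuous fun t => trigPoly lam g t c := by
  simp only [trigPoly_apply]; fun_prop

lemma trigPoly_mem_span (c : ι →₀ ℂ) (t : ℝ) :
    trigPoly lam g t c ∈ Submodule.span ℂ (range g) := by
  rw [trigPoly_apply]
  exact Submodule.sum_mem _ fun i _ => Submodule.smul_mem _ _ <| Submodule.smul_mem _ _ <|
    Submodule.subset_span ⟨i, rfl⟩

/-- Chebyshev's inequality for exponential polynomials over long time intervals. -/
lemma eventually_volume_lt_norm_le (c : ι →₀ ℂ) (hc : Set.InjOn lam c.support) {M : ℝ}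
    (hM : c.sum (fun _ a => ‖a‖ ^ 2) < M) :
    ∀ᶠ T : ℝ in atTop, ∀ a > 0,
      volume ({t | a < ‖trigPoly lam (fun _ => (1 : ℂ)) t c‖} ∩ Icc 0 T) ≤
        ENNReal.ofReal (M * T / a ^ 2) := by
  set Z : ℝ → ℂ := fun t => trigPoly lam (fun _ => (1 : ℂ)) t c with hZ
  have hZc : Continuous Z := by fun_prop
  have hreal : Tendsto (fun T : ℝ => T⁻¹ * ∫ t in (0 : ℝ)..T, ‖Z t‖ ^ 2) atTop
      (𝓝 (c.sum fun _ a => ‖a‖ ^ 2)) := by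
    have := (Complex.continuous_re.tendsto _).comp (hasMean_norm_sq c.support lam hc c)
    refine this.congr fun T => ?_
    simp only [Function.comp_apply, hZ, trigPoly_one_apply]
    rw [intervalIntegral.integral_ofReal, ← Complex.ofReal_inv, ← Complex.ofReal_mul,
      Complex.ofReal_re]
  filter_upwards [hreal.eventually (gt_mem_nhds hM), eventually_gt_atTop 0] with T hT hT0 a ha
  rw [inv_mul_eq_div, div_lt_iff₀ hT0, intervalIntegral.integral_of_le hT0.le,
    ← integral_Icc_eq_integral_Ioc] at hT
  have hi : IntegrableOn (fun t => ‖Z t‖ ^ 2) (Icc 0 T) := by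
    exact (Continuous.integrableOn_Icc (by fun_prop))
  have h1 := mul_meas_ge_le_integral_of_nonneg (μ := volume.restrict (Icc 0 T))
    (ae_of_all _ fun t => by positivity) hi (a ^ 2)
  have hset : MeasurableSet {t | a < ‖Z t‖} := measurableSet_lt measurable_const (by fun_prop)
  have h2 : volume.real ({t | a < ‖Z t‖} ∩ Icc 0 T) ≤
      (volume.restrict (Icc 0 T)).real {t | a ^ 2 ≤ ‖Z t‖ ^ 2} := by
    rw [← measureReal_restrict_apply hset]
    refine measureReal_mono fun t ht => ?_
    exact pow_le_pow_left₀ ha.le (le_of_lt ht) 2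
  rw [← ENNReal.ofReal_toReal (a := volume ({t | a < ‖Z t‖} ∩ Icc 0 T))
    ((measure_mono inter_subset_right).trans_lt measure_Icc_lt_top).ne]
  refine ENNReal.ofReal_le_ofReal ?_
  rw [le_div_iff₀ (by positivity)]
  change volume.real _ * _ ≤ _
  nlinarith [mul_le_mul_of_nonneg_left h2 (sq_nonneg a)]

/-- There is always a new frequency independent of finitely many given ones. -/
lemma exists_notMem_span {S : Set ι} {l : ℝ}
    (hS : ∀ ρ > 0, ∀ C : Set ℝ, C.Countable → ∃ i ∈ S, |lam i - l| < ρ ∧ lam i ∉ C)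
    {ρ : ℝ} (hρ : 0 < ρ) (s : Finset ι) :
    ∃ i ∈ S, |lam i - l| < ρ ∧ lam i ∉ Submodule.span ℚ (lam '' s) := by
  have : Countable (Submodule.span ℚ (lam '' s)) := by
    rw [image_eq_range]; infer_instance
  exact hS ρ hρ (Submodule.span ℚ (lam '' s)) (Set.to_countable _)

/-- Exponential polynomials that are negligible for most of the time, uniformly over all time
intervals `[0, T]`, although their coefficients can add up to `m`. It is a sum of `m` differences
`(e ^ (i α t) - e ^ (i β t)) / 2`, chosen one after the other with `α - β` so small that the new
difference stays below `η` until the mean square of the sum of the preceding ones has settled.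
Thus at any time scale all but one of the differences either are still small or are already
orthogonal to each other. -/
lemma exists_flat_scalar {S : Set ι} {l : ℝ}
    (hS : ∀ ρ > 0, ∀ C : Set ℝ, C.Countable → ∃ i ∈ S, |lam i - l| < ρ ∧ lam i ∉ C)
    (s : Finset ι) (hs : LinearIndepOn ℚ lam (s : Set ι)) {η : ℝ} (hη : 0 < η) (T₀ : ℝ) (m : ℕ) :
    ∃ (s' : Finset ι) (c : ι →₀ ℂ), s ⊆ s' ∧ LinearIndepOn ℚ lam (s' : Set ι) ∧
      (∀ i ∈ c.support, i ∈ s' ∧ i ∉ s ∧ i ∈ S) ∧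
      c.sum (fun _ a => ‖a‖) = m ∧ c.sum (fun _ a => ‖a‖ ^ 2) = m / 2 ∧
      (∀ t, |t| ≤ T₀ → ‖trigPoly lam (fun _ => (1 : ℂ)) t c‖ ≤ m * η) ∧
      ∀ T > 0, ∀ a > 0,
        volume ({t | a + (1 + m * η) < ‖trigPoly lam (fun _ => (1 : ℂ)) t c‖} ∩ Icc 0 T) ≤
          ENNReal.ofReal (m * T / a ^ 2) := by
  classical
  induction m with
  | zero =>
    refine ⟨s, 0, subset_rfl, hs, by simp, by simp, by simp, by simp, fun T hT a ha => ?_⟩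
    have : {t : ℝ | a + (1 + (0 : ℕ) * η) < ‖trigPoly lam (fun _ => (1 : ℂ)) t 0‖} = ∅ := by
      ext t; simp; linarith
    rw [this]; simp
  | succ m ih =>
    obtain ⟨s', c, hss', hs', hc, hc1, hc2, hsmall, hbad⟩ := ih
    obtain ⟨τ, hτ⟩ := eventually_atTop.1 <| eventually_volume_lt_norm_le (M := (m + 1 : ℕ)) c
      (hs'.injOn.mono fun i hi => (hc i hi).1)
      (by rw [hc2]; push_cast; linarith [m.cast_nonneg (α := ℝ)])
    set R : ℝ := max 1 (max T₀ τ)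
    have hR : 0 < R := lt_of_lt_of_le one_pos (le_max_left _ _)
    obtain ⟨i, hiS, hi, hi'⟩ := exists_notMem_span hS (div_pos hη hR) s'
    have hind := hs'.insert hi'
    rw [← Finset.coe_insert] at hind
    obtain ⟨j, hjS, hj, hj'⟩ := exists_notMem_span hS (div_pos hη hR) (insert i s')
    have hind2 := hind.insert hj'
    rw [← Finset.coe_insert] at hind2
    have his : i ∉ s' := fun h => hi' (Submodule.subset_span ⟨i, h, rfl⟩)
    have hjs : j ∉ insert i s' := fun h => hj' (Submodule.subset_span ⟨j, h, rfl⟩)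
    have hij : i ≠ j := by rintro rfl; simp at hjs
    rw [Finset.mem_insert, not_or] at hjs
    set w : ι →₀ ℂ := Finsupp.single i (1 / 2) + Finsupp.single j (-(1 / 2)) with hw
    have hsingle : ∀ (k : ι) (a : ℂ), a ≠ 0 → (Finsupp.single k a).support = {k} := by
      intro k a ha; ext l; simp [ha, eq_comm]
    have hdij : Disjoint (Finsupp.single i (1 / 2 : ℂ)).support
        (Finsupp.single j (-(1 / 2) : ℂ)).support := by
      rw [hsingle _ _ (by norm_num),
        hsingle _ _ (by norm_num)]
      simpa using hij
    have hwsupp : w.support = {i, j} := by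
      rw [hw, Finsupp.support_add_eq hdij, hsingle _ _ (by norm_num),
        hsingle _ _ (by norm_num)]
      rfl
    have hdisj : Disjoint c.support w.support := by
      rw [hwsupp, Finset.disjoint_left]
      intro k hk hk'
      have := (hc k hk).1
      rcases Finset.mem_insert.1 hk' with rfl | h
      · exact his this
      · exact hjs.2 (Finset.mem_singleton.1 h ▸ this)
    have hwZ : ∀ t, trigPoly lam (fun _ => (1 : ℂ)) t w =
        (1 / 2) * (phase (lam i) t - phase (lam j) t) := by
      intro t
      simp [hw, trigPoly, Finsupp.linearCombination_single]; ring
    have hw1 : ∀ t, ‖trigPoly lam (fun _ => (1 : ℂ)) t w‖ ≤ 1 := by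
      intro t
      rw [hwZ, norm_mul]
      have := norm_sub_le (phase (lam i) t) (phase (lam j) t)
      simp only [norm_phase] at this
      norm_num; linarith
    have hw2 : ∀ t, |t| ≤ R → ‖trigPoly lam (fun _ => (1 : ℂ)) t w‖ ≤ η := by
      intro t ht
      rw [hwZ, norm_mul]
      have h1 := norm_phase_sub_phase_le (lam i) (lam j) t
      have h2 : |lam i - lam j| ≤ 2 * (η / R) := by
        have := abs_sub_le (lam i) l (lam j)
        rw [abs_sub_comm l] at this; linarith
      have h3 : |lam i - lam j| * |t| ≤ 2 * (η / R) * R := by gcongr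
      have h4 : 2 * (η / R) * R = 2 * η := by field_simp
      norm_num; linarith
    refine ⟨insert j (insert i s'), c + w, ?_, hind2, ?_, ?_, ?_, ?_, ?_⟩
    · exact hss'.trans ((Finset.subset_insert _ _).trans (Finset.subset_insert _ _))
    · intro k hk
      rw [Finsupp.support_add_eq hdisj, hwsupp] at hk
      simp only [Finset.mem_union, Finset.mem_insert, Finset.mem_singleton] at hk
      rcases hk with hk | rfl | rfl
      · have := hc k hk
        exact ⟨by simp [this.1], this.2⟩
      · exact ⟨by simp, fun h => his (hss' h), hiS⟩
      · exact ⟨by simp, fun h => hjs.2 (hss' h), hjS⟩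
    · rw [Finsupp.sum_add_index_of_disjoint hdisj, hc1, hw,
        Finsupp.sum_add_index_of_disjoint hdij, Finsupp.sum_single_index (by simp),
        Finsupp.sum_single_index (by simp)]
      norm_num
    · rw [Finsupp.sum_add_index_of_disjoint hdisj, hc2, hw,
        Finsupp.sum_add_index_of_disjoint hdij, Finsupp.sum_single_index (by simp),
        Finsupp.sum_single_index (by simp)]
      norm_num; ring
    · intro t ht
      rw [map_add]
      refine (norm_add_le _ _).trans ?_
      have h1 := hw2 t (ht.trans ((le_max_left _ _).trans (le_max_right _ _)))
      have h2 := hsmall t ht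
      push_cast; linarith
    · intro T hT a ha
      rcases le_total T R with hTR | hTR
      · refine (measure_mono ?_).trans ((hbad T hT a ha).trans (ENNReal.ofReal_le_ofReal ?_))
        · rintro t ⟨ht, htT⟩
          refine ⟨?_, htT⟩
          rw [mem_ofPred_eq, map_add] at ht
          rw [mem_ofPred_eq]
          have h1 := hw2 t (by rw [abs_of_nonneg htT.1]; exact htT.2.trans hTR)
          have h2 := norm_add_le (trigPoly lam (fun _ => (1 : ℂ)) t c)
            (trigPoly lam (fun _ => (1 : ℂ)) t w)
          push_cast at ht; linarith
        · gcongr; simp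
      · refine (measure_mono ?_).trans (hτ T (((le_max_right _ _).trans
          (le_max_right _ _)).trans hTR) a ha)
        rintro t ⟨ht, htT⟩
        refine ⟨?_, htT⟩
        rw [mem_ofPred_eq, map_add] at ht
        rw [mem_ofPred_eq]
        have h2 := norm_add_le (trigPoly lam (fun _ => (1 : ℂ)) t c)
          (trigPoly lam (fun _ => (1 : ℂ)) t w)
        have h3 : 0 ≤ ((m + 1 : ℕ) : ℝ) * η := by positivity
        linarith [hw1 t]

variable (lam g) in
/-- The vector `y` is attained by blocks: for any finite set `s` of frequencies in use there is
an exponential polynomial with new frequencies, independent of the old ones, which is small on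
`[-T₀, T₀]` and outside a set of times of proportion `δ` in every interval `[0, T]`, and which
takes a value close to `y` when the phases are set appropriately. -/
def IsBlockAttainable (y : X) : Prop :=
  ∀ s : Finset ι, LinearIndepOn ℚ lam (s : Set ι) → ∀ ε > 0, ∀ δ > 0, ∀ T₀ : ℝ,
    ∃ (s' : Finset ι) (c : ι →₀ ℂ), s ⊆ s' ∧ LinearIndepOn ℚ lam (s' : Set ι) ∧
      (∀ i ∈ c.support, i ∈ s' ∧ i ∉ s) ∧
      (∀ t, |t| ≤ T₀ → ‖trigPoly lam g t c‖ ≤ ε) ∧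
      (∀ T > 0, volume ({t | ε < ‖trigPoly lam g t c‖} ∩ Icc 0 T) ≤ ENNReal.ofReal (δ * T)) ∧
      ∃ θ : ι → ℂ, (∀ i, ‖θ i‖ = 1) ∧
        ‖Finsupp.linearCombination ℂ (fun i => θ i • g i) c - y‖ ≤ ε

variable (lam g) in
/-- Every index `i` is a condensation point for the frequencies and vectors jointly: arbitrarily
close to `(λ_i, g_i)` there are pairs `(λ_j, g_j)` with `λ_j` outside a given countable set. -/
def IsCondensed : Prop :=
  ∀ i, ∀ ε > 0, ∀ C : Set ℝ, C.Countable → ∃ j, |lam j - lam i| < ε ∧ ‖g j - g i‖ < ε ∧ lam j ∉ C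

/-- The block is `1 / m` times the one from `exists_flat_scalar`, with all `g i` close to `g i₀`. -/
lemma IsCondensed.isBlockAttainable (h : IsCondensed lam g) (i₀ : ι) :
    IsBlockAttainable lam g (g i₀) := by
  intro s hs ε hε δ hδ T₀
  set G : ℝ := ‖g i₀‖ + 1 with hG
  have hG0 : 0 < G := by positivity
  set η : ℝ := ε / (8 * G) with hη
  have hη0 : 0 < η := by positivity
  have hηG : η * G = ε / 8 := by rw [hη]; field_simp
  obtain ⟨m, hm⟩ := exists_nat_gt (max (1 / η) (16 * G ^ 2 / (ε ^ 2 * δ)))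
  have hm1 : 1 / η < m := (le_max_left _ _).trans_lt hm
  have hm2 : 16 * G ^ 2 / (ε ^ 2 * δ) < m := (le_max_right _ _).trans_lt hm
  have hm0 : (0 : ℝ) < m := lt_trans (by positivity) hm1
  rw [div_lt_iff₀ hη0] at hm1
  rw [div_lt_iff₀ (by positivity)] at hm2
  obtain ⟨s', c, hss', hs', hc, hc1, -, hsmall, hbad⟩ := exists_flat_scalar
    (S := {j | ‖g j - g i₀‖ < η}) (lam := lam) (l := lam i₀) (fun ρ hρ C hC => by
      obtain ⟨j, h1, h2, h3⟩ := h i₀ (min ρ η) (lt_min hρ hη0) C hC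
      exact ⟨j, h2.trans_le (min_le_right _ _), h1.trans_le (min_le_left _ _), h3⟩)
    s hs hη0 T₀ m
  -- replacing every `g i` by `g i₀` costs at most `m η`
  have hrep : ∀ u : ι → ℂ, (∀ i, ‖u i‖ = 1) →
      ‖∑ i ∈ c.support, c i • u i • g i - (∑ i ∈ c.support, c i * u i) • g i₀‖ ≤ m * η := by
    intro u hu
    rw [Finset.sum_smul, ← Finset.sum_sub_distrib, ← hc1, Finsupp.sum, Finset.sum_mul]
    refine norm_sum_le_of_le _ fun i hi => ?_
    rw [mul_smul, ← smul_sub, ← smul_sub, norm_smul, norm_smul, hu, one_mul]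
    gcongr
    exact (hc i hi).2.2.le
  have hmul : ∀ (v : ι → X), Finsupp.linearCombination ℂ v ((m : ℂ)⁻¹ • c) =
      (m : ℂ)⁻¹ • ∑ i ∈ c.support, c i • v i := fun v => by
    rw [map_smul, Finsupp.linearCombination_apply, Finsupp.sum]
  have hbound : ∀ t, ‖trigPoly lam g t ((m : ℂ)⁻¹ • c)‖ ≤
      (m : ℝ)⁻¹ * (‖trigPoly lam (fun _ => (1 : ℂ)) t c‖ * G) + η := by
    intro t
    rw [trigPoly, hmul, norm_smul, norm_inv, Complex.norm_natCast, trigPoly_one_apply]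
    have h1 := hrep (fun i => phase (lam i) t) fun i => norm_phase _ _
    have h2 := norm_le_norm_add_norm_sub' (∑ i ∈ c.support, c i • phase (lam i) t • g i)
      ((∑ i ∈ c.support, c i * phase (lam i) t) • g i₀)
    rw [norm_smul] at h2
    have h3 : ‖∑ i ∈ c.support, c i * phase (lam i) t‖ * ‖g i₀‖ ≤
        ‖∑ i ∈ c.support, c i * phase (lam i) t‖ * G := by gcongr; linarith
    calc _ ≤ (m : ℝ)⁻¹ * (‖∑ i ∈ c.support, c i * phase (lam i) t‖ * G + m * η) := by
          gcongr; linarith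
      _ = _ := by field_simp
  have hηε : η ≤ ε / 8 := by rw [← hηG]; nlinarith [norm_nonneg (g i₀)]
  -- these phases turn every coefficient `c i` into its absolute value
  set θ : ι → ℂ := fun i => if c i = 0 then 1 else (starRingEnd ℂ) (c i) / ‖c i‖ with hθ
  have hθ1 : ∀ i, ‖θ i‖ = 1 := by
    intro i
    simp only [hθ]
    split_ifs with h0
    · simp
    · have : ‖c i‖ ≠ 0 := by simpa using h0
      simp [this]
  refine ⟨s', (m : ℂ)⁻¹ • c, hss', hs', fun i hi => ?_, fun t ht => ?_, fun T hT => ?_,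
    θ, hθ1, ?_⟩
  · have := hc i (Finsupp.support_smul hi)
    exact ⟨this.1, this.2.1⟩
  · refine (hbound t).trans ?_
    have h4 : (m : ℝ)⁻¹ * (‖trigPoly lam (fun _ => (1 : ℂ)) t c‖ * G) ≤
        (m : ℝ)⁻¹ * ((m * η) * G) := by gcongr; exact hsmall t ht
    have h5 : (m : ℝ)⁻¹ * ((m * η) * G) = ε / 8 := by rw [← hηG]; field_simp
    linarith
  · have ha : 0 < m * ε / (4 * G) := by positivity
    refine (measure_mono ?_).trans ((hbad T hT _ ha).trans (ENNReal.ofReal_le_ofReal ?_))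
    · rintro t ⟨ht, htT⟩
      refine ⟨?_, htT⟩
      rw [mem_ofPred_eq] at ht ⊢
      by_contra! hcon
      have h4 : (m : ℝ)⁻¹ * (‖trigPoly lam (fun _ => (1 : ℂ)) t c‖ * G) ≤
        (m : ℝ)⁻¹ * ((m * ε / (4 * G) + (1 + m * η)) * G) := by gcongr
      have h5 : (m : ℝ)⁻¹ * ((m * ε / (4 * G) + (1 + m * η)) * G) ≤
          (m : ℝ)⁻¹ * ((m * ε / (4 * G) + (m * η + m * η)) * G) := by gcongr
      have h6 : (m : ℝ)⁻¹ * ((m * ε / (4 * G) + (m * η + m * η)) * G) = ε / 4 + 2 * (η * G) := by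
        field_simp; ring
      linarith [hbound t]
    · rw [div_le_iff₀ (by positivity)]
      have : δ * T * (m * ε / (4 * G)) ^ 2 = T * m * (m * (ε ^ 2 * δ)) / (16 * G ^ 2) := by
        field_simp; ring
      rw [this, le_div_iff₀ (by positivity)]
      have : 0 ≤ T * m := by positivity
      nlinarith
  · have hsum : ∑ i ∈ c.support, c i * θ i = m := by
      have : (m : ℂ) = ((c.sum fun _ a => ‖a‖ : ℝ) : ℂ) := by rw [hc1]; simp
      rw [this, Finsupp.sum, Complex.ofReal_sum]
      refine Finset.sum_congr rfl fun i hi => ?_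
      have h0 : c i ≠ 0 := Finsupp.mem_support_iff.1 hi
      have h1 : (‖c i‖ : ℂ) ≠ 0 := by simpa using h0
      simp only [hθ, if_neg h0]
      rw [← mul_div_assoc, Complex.mul_conj', div_eq_iff h1, sq]
    have h1 := hrep θ hθ1
    rw [hsum] at h1
    have hmC : (m : ℂ) ≠ 0 := by exact_mod_cast hm0.ne'
    have h2 : g i₀ = (m : ℂ)⁻¹ • (m : ℂ) • g i₀ := by rw [inv_smul_smul₀ hmC]
    rw [hmul, h2, ← smul_sub, norm_smul, norm_inv, Complex.norm_natCast]
    calc _ ≤ (m : ℝ)⁻¹ * (m * η) := by gcongr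
      _ = η := by field_simp
      _ ≤ ε := by linarith

lemma isBlockAttainable_zero : IsBlockAttainable lam g 0 := by
  intro s hs ε hε δ hδ T₀
  refine ⟨s, 0, subset_rfl, hs, by simp, by simp [hε.le], fun T hT => ?_, fun _ => 1, by simp,
    by simp [hε.le]⟩
  simp [hε.not_gt]

lemma IsBlockAttainable.smul {y : X} (hy : IsBlockAttainable lam g y) (a : ℂ) :
    IsBlockAttainable lam g (a • y) := by
  intro s hs ε hε δ hδ T₀
  have ha : 0 < ‖a‖ + 1 := by positivity
  obtain ⟨s', c, hss', hs', hc, h1, h2, θ, hθ, h3⟩ :=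
    hy s hs (ε / (‖a‖ + 1)) (by positivity) δ hδ T₀
  have key : ∀ v : X, ‖v‖ ≤ ε / (‖a‖ + 1) → ‖a • v‖ ≤ ε := fun v hv => by
    rw [norm_smul]
    calc _ ≤ (‖a‖ + 1) * (ε / (‖a‖ + 1)) := by gcongr; linarith
      _ = ε := by field_simp
  refine ⟨s', a • c, hss', hs', fun i hi => hc i (Finsupp.support_smul hi), fun t ht => ?_,
    fun T hT => ?_, θ, hθ, ?_⟩
  · rw [map_smul]; exact key _ (h1 t ht)
  · refine (measure_mono ?_).trans (h2 T hT)
    rintro t ⟨ht, htT⟩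
    refine ⟨?_, htT⟩
    rw [mem_ofPred_eq] at ht ⊢
    by_contra! hcon
    rw [map_smul] at ht
    exact absurd (key _ hcon) ht.not_ge
  · rw [map_smul, ← smul_sub]; exact key _ h3

lemma IsBlockAttainable.add {y z : X} (hy : IsBlockAttainable lam g y)
    (hz : IsBlockAttainable lam g z) : IsBlockAttainable lam g (y + z) := by
  classical
  intro s hs ε hε δ hδ T₀
  obtain ⟨s₁, c₁, hss₁, hs₁, hc₁, h1, h2, θ₁, hθ₁, h3⟩ :=
    hy s hs (ε / 2) (by positivity) (δ / 2) (by positivity) T₀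
  obtain ⟨s₂, c₂, hss₂, hs₂, hc₂, h1', h2', θ₂, hθ₂, h3'⟩ :=
    hz s₁ hs₁ (ε / 2) (by positivity) (δ / 2) (by positivity) T₀
  refine ⟨s₂, c₁ + c₂, hss₁.trans hss₂, hs₂, fun i hi => ?_, fun t ht => ?_, fun T hT => ?_,
    fun i => if i ∈ s₁ then θ₁ i else θ₂ i, fun i => ?_, ?_⟩
  · rcases Finset.mem_union.1 (Finsupp.support_add hi) with h | h
    · exact ⟨hss₂ (hc₁ i h).1, (hc₁ i h).2⟩
    · exact ⟨(hc₂ i h).1, fun hs => (hc₂ i h).2 (hss₁ hs)⟩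
  · rw [map_add]
    linarith [norm_add_le (trigPoly lam g t c₁) (trigPoly lam g t c₂), h1 t ht, h1' t ht]
  · have : {t | ε < ‖trigPoly lam g t (c₁ + c₂)‖} ∩ Icc 0 T ⊆
        ({t | ε / 2 < ‖trigPoly lam g t c₁‖} ∩ Icc 0 T) ∪
        ({t | ε / 2 < ‖trigPoly lam g t c₂‖} ∩ Icc 0 T) := by
      rintro t ⟨ht, htT⟩
      rw [mem_ofPred_eq, map_add] at ht
      by_contra hcon
      simp only [mem_union, mem_inter_iff, mem_ofPred_eq, htT, and_true, not_or, not_lt] at hcon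
      linarith [norm_add_le (trigPoly lam g t c₁) (trigPoly lam g t c₂)]
    calc _ ≤ _ := measure_mono this
      _ ≤ _ := measure_union_le _ _
      _ ≤ ENNReal.ofReal (δ / 2 * T) + ENNReal.ofReal (δ / 2 * T) :=
          add_le_add (h2 T hT) (h2' T hT)
      _ = _ := by rw [← ENNReal.ofReal_add (by positivity) (by positivity)]; congr 1; ring
  · dsimp only
    split_ifs
    exacts [hθ₁ i, hθ₂ i]
  · have e1 : Finsupp.linearCombination ℂ
        (fun i => (if i ∈ s₁ then θ₁ i else θ₂ i) • g i) c₁ =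
        Finsupp.linearCombination ℂ (fun i => θ₁ i • g i) c₁ := by
      simp only [Finsupp.linearCombination_apply, Finsupp.sum]
      exact Finset.sum_congr rfl fun i hi => by rw [if_pos (hc₁ i hi).1]
    have e2 : Finsupp.linearCombination ℂ
        (fun i => (if i ∈ s₁ then θ₁ i else θ₂ i) • g i) c₂ =
        Finsupp.linearCombination ℂ (fun i => θ₂ i • g i) c₂ := by
      simp only [Finsupp.linearCombination_apply, Finsupp.sum]
      exact Finset.sum_congr rfl fun i hi => by rw [if_neg (hc₂ i hi).2]
    rw [map_add, e1, e2, add_sub_add_comm]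
    exact (norm_add_le _ _).trans (by linarith)

lemma IsCondensed.isBlockAttainable_of_mem_span (h : IsCondensed lam g) {y : X}
    (hy : y ∈ Submodule.span ℂ (range g)) : IsBlockAttainable lam g y := by
  induction hy using Submodule.span_induction with
  | mem x hx => obtain ⟨i, rfl⟩ := hx; exact h.isBlockAttainable i
  | zero => exact isBlockAttainable_zero
  | add x y _ _ hx hy => exact hx.add hy
  | smul a x _ hx => exact hx.smul a

/-- One step of the construction: add to an exponential polynomial with independent frequencies
a block that is small most of the time, so that the sum visits the `ε`-ball about `y` with
positive lower density. -/
lemma IsCondensed.exists_step (h : IsCondensed lam g) (s : Finset ι)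
    (hs : LinearIndepOn ℚ lam (s : Set ι)) (c : ι →₀ ℂ) (hc : c.support ⊆ s) {y : X}
    (hy : y ∈ Submodule.span ℂ (range g)) {ε δ : ℝ} (hε : 0 < ε) (hδ : 0 < δ) (T₀ : ℝ) :
    ∃ (s' : Finset ι) (c' : ι →₀ ℂ) (d : ℝ), LinearIndepOn ℚ lam (s' : Set ι) ∧
      c'.support ⊆ s' ∧ 0 < d ∧
      (∀ t, |t| ≤ T₀ → ‖trigPoly lam g t (c' - c)‖ ≤ ε) ∧
      (∀ T > 0, volume ({t | ε < ‖trigPoly lam g t (c' - c)‖} ∩ Icc 0 T) ≤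
        ENNReal.ofReal (δ * T)) ∧
      ∀ᶠ T in atTop, ENNReal.ofReal (d * T) ≤
        volume ({t | ‖trigPoly lam g t c' - y‖ < ε} ∩ Icc 0 T) := by
  classical
  -- the old frequencies are to return to phase `1`, where the old polynomial has the value
  -- `trigPoly lam g 0 c`; the new block has to supply the difference
  obtain ⟨s', z, hss', hs', hz, h1, h2, θ, hθ, h3⟩ :=
    h.isBlockAttainable_of_mem_span (Submodule.sub_mem _ hy (trigPoly_mem_span (lam := lam) c 0))
      s hs (ε / 2) (by positivity) δ hδ T₀
  set θ' : ι → ℂ := fun i => if i ∈ s then 1 else θ i with hθ'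
  have hθ'1 : ∀ i, ‖θ' i‖ = 1 := fun i => by
    simp only [hθ']; split_ifs
    exacts [norm_one, hθ i]
  set B : ℝ := ∑ i ∈ (c + z).support, ‖(c + z) i‖ * ‖g i‖ with hB
  have hB0 : 0 ≤ B := Finset.sum_nonneg fun i _ => by positivity
  have hsupp : (c + z).support ⊆ s' := fun i hi => by
    rcases Finset.mem_union.1 (Finsupp.support_add hi) with h | h
    · exact hss' (hc h)
    · exact (hz i h).1
  obtain ⟨d, hd, hdT⟩ := kronecker_density lam s' hs' θ' hθ'1 (ε := ε / (2 * (B + 1)))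
    (by positivity)
  refine ⟨s', c + z, d, hs', hsupp, hd, fun t ht => ?_, fun T hT => ?_, hdT.mono fun T hT =>
    hT.trans (measure_mono (inter_subset_inter_left _ fun t ht => ?_))⟩
  · rw [add_sub_cancel_left]; linarith [h1 t ht]
  · rw [add_sub_cancel_left]
    refine (measure_mono (inter_subset_inter_left _ fun t ht => ?_)).trans (h2 T hT)
    rw [mem_ofPred_eq] at ht ⊢; linarith
  · rw [mem_ofPred_eq] at ht ⊢
    have e1 : Finsupp.linearCombination ℂ (fun i => θ' i • g i) c = trigPoly lam g 0 c := by
      simp only [trigPoly, Finsupp.linearCombination_apply, Finsupp.sum]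
      exact Finset.sum_congr rfl fun i hi => by simp [hθ', hc hi]
    have e2 : Finsupp.linearCombination ℂ (fun i => θ' i • g i) z =
        Finsupp.linearCombination ℂ (fun i => θ i • g i) z := by
      simp only [Finsupp.linearCombination_apply, Finsupp.sum]
      exact Finset.sum_congr rfl fun i hi => by simp [hθ', (hz i hi).2]
    have e3 : ‖trigPoly lam g t (c + z) -
        Finsupp.linearCombination ℂ (fun i => θ' i • g i) (c + z)‖ ≤
        ε / (2 * (B + 1)) * B := by
      rw [trigPoly, Finsupp.linearCombination_apply, Finsupp.linearCombination_apply, Finsupp.sum,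
        Finsupp.sum, ← Finset.sum_sub_distrib, hB, Finset.mul_sum]
      refine norm_sum_le_of_le _ fun i hi => ?_
      rw [← smul_sub, ← sub_smul, norm_smul, norm_smul]
      have := (ht i (hsupp hi)).le
      calc _ ≤ ‖(c + z) i‖ * (ε / (2 * (B + 1)) * ‖g i‖) := by gcongr
        _ = _ := by ring
    have e4 : ε / (2 * (B + 1)) * B < ε / 2 := by
      rw [div_mul_eq_mul_div, div_lt_div_iff₀ (by positivity) two_pos]; nlinarith
    have e5 : trigPoly lam g t (c + z) - y = (trigPoly lam g t (c + z) -
        Finsupp.linearCombination ℂ (fun i => θ' i • g i) (c + z)) +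
        (Finsupp.linearCombination ℂ (fun i => θ i • g i) z - (y - trigPoly lam g 0 c)) := by
      rw [map_add (Finsupp.linearCombination ℂ _), e1, e2]; abel
    rw [e5]
    exact (norm_add_le _ _).trans_lt (by linarith)

end TrigPoly

/-! ### Limits that visit balls with positive lower density -/

lemma lowerDensity_pos_of_eventually {S : Set ℝ} {d : ℝ} (hd : 0 < d)
    (h : ∀ᶠ T : ℝ in atTop, ENNReal.ofReal (d * T) ≤ volume (S ∩ Icc 0 T)) :
    0 < lowerDensity S := by
  refine (ENNReal.ofReal_pos.2 hd).trans_le (le_liminf_of_le (by isBoundedDefault) ?_)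
  filter_upwards [h, eventually_gt_atTop 0] with T hT hT0
  rw [ENNReal.le_div_iff_mul_le (Or.inl (by simpa using hT0)) (Or.inl ENNReal.ofReal_ne_top),
    ← ENNReal.ofReal_mul hd.le]
  exact hT

lemma lowerDensity_mono {S S' : Set ℝ} (h : S ⊆ S') : lowerDensity S ≤ lowerDensity S' :=
  liminf_le_liminf (Eventually.of_forall fun _ =>
    ENNReal.div_le_div_right (measure_mono (inter_subset_inter_left _ h)) _)

section Limit

variable {ι X : Type*} [NormedAddCommGroup X] [NormedSpace ℂ X] {lam : ι → ℝ} {g : ι → X}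

variable (lam) in
/-- A stage of the construction: a finite set of independent frequencies, an exponential
polynomial with frequencies among them, and a positive lower bound `d` for the densities of the
visits arranged so far. -/
structure Stage where
  s : Finset ι
  c : ι →₀ ℂ
  d : ℝ
  indep : LinearIndepOn ℚ lam (s : Set ι)
  supp : c.support ⊆ s
  d_pos : 0 < d

/-- The sequence of exponential polynomials. The `k`-th increment is at most `2 ^ (-k)` outside
sets of times so sparse that, taken together for all `k > l`, they destroy at most half of the
visits to the ball about `y l`. -/
lemma IsCondensed.exists_stages (h : IsCondensed lam g) (y : ℕ → X)
    (hy : ∀ k, y k ∈ Submodule.span ℂ (range g)) :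
    ∃ (c : ℕ → ι →₀ ℂ) (d : ℕ → ℝ), c 0 = 0 ∧ Antitone d ∧ (∀ k, 0 < d k) ∧
      (∀ (k : ℕ) (t : ℝ), |t| ≤ k → ‖trigPoly lam g t (c (k + 1) - c k)‖ ≤ (1 / 2) ^ k) ∧
      (∀ (k : ℕ), ∀ T > 0,
        volume ({t | (1 / 2) ^ k < ‖trigPoly lam g t (c (k + 1) - c k)‖} ∩ Icc 0 T) ≤
          ENNReal.ofReal (d k * (1 / 2) ^ k / 4 * T)) ∧
      ∀ (k : ℕ), ∀ᶠ T in atTop, ENNReal.ofReal (d (k + 1) * T) ≤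
        volume ({t | ‖trigPoly lam g t (c (k + 1)) - y k‖ < (1 / 2) ^ k} ∩ Icc 0 T) := by
  have step : ∀ (k : ℕ) (σ : Stage lam), ∃ σ' : Stage lam, σ'.d ≤ σ.d ∧
      (∀ t : ℝ, |t| ≤ k → ‖trigPoly lam g t (σ'.c - σ.c)‖ ≤ (1 / 2) ^ k) ∧
      (∀ T > 0, volume ({t | (1 / 2) ^ k < ‖trigPoly lam g t (σ'.c - σ.c)‖} ∩ Icc 0 T) ≤
          ENNReal.ofReal (σ.d * (1 / 2) ^ k / 4 * T)) ∧
      ∀ᶠ T in atTop, ENNReal.ofReal (σ'.d * T) ≤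
        volume ({t | ‖trigPoly lam g t σ'.c - y k‖ < (1 / 2) ^ k} ∩ Icc 0 T) := by
    intro k σ
    have := σ.d_pos
    obtain ⟨s', c', d, hs', hc', hd, h1, h2, h3⟩ := h.exists_step σ.s σ.indep σ.c σ.supp (hy k)
      (ε := (1 / 2) ^ k) (δ := σ.d * (1 / 2) ^ k / 4) (by positivity) (by positivity) k
    refine ⟨⟨s', c', min σ.d d, hs', hc', lt_min σ.d_pos hd⟩, min_le_left _ _, h1, h2, ?_⟩
    filter_upwards [h3, eventually_ge_atTop 0] with T hT hT0
    refine le_trans (ENNReal.ofReal_le_ofReal ?_) hT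
    exact mul_le_mul_of_nonneg_right (min_le_right _ _) hT0
  choose next hd h1 h2 h3 using step
  let σ : ℕ → Stage lam := fun k =>
    Nat.rec ⟨∅, 0, 1, by simp, by simp, one_pos⟩ (fun k σ => next k σ) k
  exact ⟨fun k => (σ k).c, fun k => (σ k).d, rfl, antitone_nat_of_succ_le fun k => hd k (σ k),
    fun k => (σ k).d_pos, fun k => h1 k (σ k), fun k => h2 k (σ k), fun k => h3 k (σ k)⟩

/-- If the pairs `(λ_i, g_i)` are condensed, then a limit of exponential polynomials visits every
ball about a point of the span of the `g_i` with positive lower density. -/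
theorem IsCondensed.exists_frequently_visiting [CompleteSpace X] [SecondCountableTopology X]
    (h : IsCondensed lam g) :
    ∃ (c : ℕ → ι →₀ ℂ) (U : ℝ → X),
      TendstoLocallyUniformly (fun k t => trigPoly lam g t (c k)) U atTop ∧
      ∀ y ∈ Submodule.span ℂ (range g), ∀ ε > 0, 0 < lowerDensity {t | 0 ≤ t ∧ ‖U t - y‖ < ε} := by
  set K : Submodule ℂ X := Submodule.span ℂ (range g) with hK
  -- a dense sequence in which every term is repeated infinitely often
  set y : ℕ → X := fun k => (TopologicalSpace.denseSeq K k.unpair.1 : X) with hy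
  obtain ⟨c, d, hc0, hdanti, hdpos, hA, hB, hC⟩ := h.exists_stages y fun k => Subtype.mem _
  set z : ℕ → ℝ → X := fun k t => trigPoly lam g t (c (k + 1) - c k) with hz
  have hsum : ∀ k t, ∑ l ∈ Finset.range k, z l t = trigPoly lam g t (c k) := by
    intro k t
    simp only [hz, map_sub]
    rw [Finset.sum_range_sub (fun k => trigPoly lam g t (c k)), hc0, map_zero, sub_zero]
  have hsummable : ∀ t, Summable fun k => z k t := by
    intro t
    refine Summable.of_norm_bounded_eventually_nat (summable_geometric_two) ?_
    filter_upwards [eventually_ge_atTop ⌈|t|⌉₊] with k hk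
    exact hA k t ((Nat.le_ceil _).trans (by exact_mod_cast hk))
  set U : ℝ → X := fun t => ∑' k, z k t with hU
  have htail : ∀ k t, (∀ l ≥ k, ‖z l t‖ ≤ (1 / 2) ^ l) →
      ‖U t - trigPoly lam g t (c k)‖ ≤ 2 * (1 / 2) ^ k := by
    intro k t ht
    have h1 : U t - trigPoly lam g t (c k) = ∑' l, z (l + k) t := by
      rw [← hsum]
      exact sub_eq_of_eq_add' ((hsummable t).sum_add_tsum_nat_add k).symm
    rw [h1]
    refine tsum_of_norm_bounded (hasSum_geometric_two' (2 * (1 / 2) ^ k)) fun l => ?_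
    refine (ht (l + k) (by omega)).trans_eq ?_
    rw [pow_add, one_div, inv_pow, inv_pow]; field_simp
  refine ⟨c, U, ?_, ?_⟩
  · rw [Metric.tendstoLocallyUniformly_iff]
    intro ε hε t
    refine ⟨Metric.ball t 1, Metric.ball_mem_nhds _ one_pos, ?_⟩
    have h1 : Tendsto (fun k : ℕ => 2 * (1 / 2 : ℝ) ^ k) atTop (𝓝 0) := by
      simpa using (tendsto_pow_atTop_nhds_zero_of_lt_one (r := (1 / 2 : ℝ)) (by norm_num)
        (by norm_num)).const_mul 2
    filter_upwards [h1.eventually (gt_mem_nhds hε), eventually_ge_atTop ⌈|t| + 1⌉₊]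
      with k hk1 hk2 t' ht'
    rw [dist_eq_norm]
    refine (htail k t' fun l hl => hA l t' ?_).trans_lt hk1
    have h2 : |t| + 1 ≤ k := (Nat.le_ceil _).trans (by exact_mod_cast hk2)
    have h3 : (k : ℝ) ≤ l := by exact_mod_cast hl
    have h4 : |t' - t| < 1 := ht'
    have h5 := abs_sub_abs_le_abs_sub t' t
    linarith
  · intro v hv ε hε
    obtain ⟨n, hn⟩ := (TopologicalSpace.denseRange_denseSeq K).exists_dist_lt ⟨v, hv⟩
      (half_pos hε)
    obtain ⟨p, hp⟩ := exists_pow_lt_of_lt_one (show 0 < ε / 4 by positivity)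
      (show (1 / 2 : ℝ) < 1 by norm_num)
    set k : ℕ := Nat.pair n p with hk
    have hkp : (1 / 2 : ℝ) ^ k < ε / 4 :=
      (pow_le_pow_of_le_one (by norm_num) (by norm_num) (Nat.right_le_pair n p)).trans_lt hp
    have hyk : ‖v - y k‖ < ε / 2 := by
      have : y k = TopologicalSpace.denseSeq K n := by simp [hy, hk]
      rw [this, ← dist_eq_norm]
      exact hn
    refine lowerDensity_pos_of_eventually (half_pos (hdpos (k + 1))) ?_
    filter_upwards [hC k, eventually_gt_atTop 0] with T hT hT0
    set Bad : ℕ → Set ℝ := fun l => {t | (1 / 2) ^ l < ‖z l t‖} ∩ Icc 0 T with hBad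
    have hcover : {t | ‖trigPoly lam g t (c (k + 1)) - y k‖ < (1 / 2) ^ k} ∩ Icc 0 T ⊆
        ({t | 0 ≤ t ∧ ‖U t - v‖ < ε} ∩ Icc 0 T) ∪ ⋃ l, Bad (l + (k + 1)) := by
      rintro t ⟨ht, htT⟩
      by_cases hb : ∃ l, t ∈ Bad (l + (k + 1))
      · exact Or.inr (mem_iUnion.2 hb)
      · push Not at hb
        refine Or.inl ⟨⟨htT.1, ?_⟩, htT⟩
        rw [mem_ofPred_eq] at ht
        have h1 := htail (k + 1) t fun l hl => by
          have := hb (l - (k + 1))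
          rw [Nat.sub_add_cancel hl] at this
          by_contra! hcon
          exact this ⟨hcon, htT⟩
        have h2 : (2 : ℝ) * (1 / 2) ^ (k + 1) = (1 / 2) ^ k := by rw [pow_succ]; ring
        have h3 : U t - v = (U t - trigPoly lam g t (c (k + 1))) +
            (trigPoly lam g t (c (k + 1)) - y k) - (v - y k) := by abel
        rw [h3]
        refine (norm_sub_le _ _).trans_lt ?_
        linarith [norm_add_le (U t - trigPoly lam g t (c (k + 1)))
          (trigPoly lam g t (c (k + 1)) - y k)]
    set a : ℝ := d (k + 1) / 2 * T with ha
    have ha0 : 0 ≤ a := by have := hdpos (k + 1); positivity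
    have hbad : volume (⋃ l, Bad (l + (k + 1))) ≤ ENNReal.ofReal a := by
      refine (measure_iUnion_le _).trans ?_
      rw [← (hasSum_geometric_two' a).tsum_eq, ENNReal.ofReal_tsum_of_nonneg
        (fun l => by positivity) (hasSum_geometric_two' a).summable]
      refine ENNReal.tsum_le_tsum fun l => (hB (l + (k + 1)) T hT0).trans
        (ENNReal.ofReal_le_ofReal ?_)
      have h1 : d (l + (k + 1)) ≤ d (k + 1) := hdanti (by omega)
      have h2 : (1 / 2 : ℝ) ^ (l + (k + 1)) ≤ (1 / 2) ^ l :=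
        pow_le_pow_of_le_one (by norm_num) (by norm_num) (by omega)
      have h3 := (hdpos (k + 1)).le
      calc d (l + (k + 1)) * (1 / 2) ^ (l + (k + 1)) / 4 * T
          ≤ d (k + 1) * (1 / 2) ^ l / 4 * T := by gcongr
        _ = a / 2 / 2 ^ l := by rw [ha, one_div, inv_pow]; field_simp; ring
    have htotal := hT.trans ((measure_mono hcover).trans ((measure_union_le _ _).trans
      (add_le_add_right hbad _)))
    have hsplit : d (k + 1) * T = a + a := by rw [ha]; ring
    rw [hsplit, ENNReal.ofReal_add ha0 ha0] at htotal
    exact (ENNReal.add_le_add_iff_right ENNReal.ofReal_ne_top).1 htotal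

end Limit

/-! ### Closed lifts of polynomials in the generators -/

section ClosedGraph

variable {E : Type u} [NormedAddCommGroup E] [NormedSpace ℂ E]

lemma IsBoundedC0Group.hasDerivAt {T : ℝ → E →L[ℂ] E} (hT : IsBoundedC0Group T) {x y : E}
    (h : HasDerivAt (fun t : ℝ => T t x) y 0) (t : ℝ) :
    HasDerivAt (fun t : ℝ => T t x) (T t y) t := by
  have h1 : HasDerivAt (fun s : ℝ => T (s - t) x) y t := by
    have := HasDerivAt.comp_sub_const (f := fun s : ℝ => T s x) (f' := y) t t (by simpa using h)
    exact this
  have h2 := ((T t).restrictScalars ℝ).hasFDerivAt.comp_hasDerivAt t h1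
  refine h2.congr_of_eventuallyEq (Eventually.of_forall fun s => ?_)
  have : T s = T t * T (s - t) := by rw [← hT.map_add]; congr 1; ring
  simp [this]

/-- The integrated form of the generator, from which its closedness is visible. -/
lemma IsBoundedC0Group.hasDerivAt_zero_iff [CompleteSpace E] {T : ℝ → E →L[ℂ] E}
    (hT : IsBoundedC0Group T) (x y : E) :
    HasDerivAt (fun t : ℝ => T t x) y 0 ↔ ∀ t : ℝ, T t x - x = ∫ s in (0 : ℝ)..t, T s y := by
  have h0 : ∀ z, T 0 z = z := fun z => by rw [hT.map_zero]; rfl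
  constructor
  · intro h t
    rw [intervalIntegral.integral_eq_sub_of_hasDerivAt (fun s _ => hT.hasDerivAt h s)
      ((hT.continuous_orbit y).intervalIntegrable _ _), h0]
  · intro h
    have h1 := intervalIntegral.integral_hasDerivAt_right (a := 0) (b := 0)
      ((hT.continuous_orbit y).intervalIntegrable _ _)
      ((hT.continuous_orbit y).stronglyMeasurableAtFilter _ _)
      (hT.continuous_orbit y).continuousAt
    rw [h0] at h1
    refine (h1.add_const x).congr_of_eventuallyEq (Eventually.of_forall fun t => ?_)
    dsimp only
    rw [← h t, sub_add_cancel]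

lemma IsGroupGenerator.isClosed_graph [CompleteSpace E] {B : E →ₗ.[ℂ] E} {T : ℝ → E →L[ℂ] E}
    (hT : IsBoundedC0Group T) (hB : IsGroupGenerator B T) :
    IsClosed (B.graph : Set (E × E)) := by
  obtain ⟨M, hM⟩ := hT.bounded
  have hset : (B.graph : Set (E × E)) =
      ⋂ t : ℝ, {q : E × E | T t q.1 - q.1 = ∫ s in (0 : ℝ)..t, T s q.2} := by
    ext ⟨x, y⟩
    simp only [SetLike.mem_coe, mem_iInter, mem_ofPred_eq]
    rw [hB x y, hT.hasDerivAt_zero_iff]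
  rw [hset]
  refine isClosed_iInter fun t => isClosed_eq (by fun_prop) ?_
  let J : E →ₗ[ℂ] E :=
    { toFun := fun y => ∫ s in (0 : ℝ)..t, T s y
      map_add' := fun y z => by
        simp only [map_add]
        exact intervalIntegral.integral_add ((hT.continuous_orbit y).intervalIntegrable _ _)
          ((hT.continuous_orbit z).intervalIntegrable _ _)
      map_smul' := fun a y => by
        simp only [map_smul, RingHom.id_apply]
        exact intervalIntegral.integral_smul a _ }
  have hJ : Continuous J := AddMonoidHomClass.continuous_of_bound J (M * |t|) fun y => by
    have : ∀ s ∈ Set.uIoc 0 t, ‖T s y‖ ≤ M * ‖y‖ := fun s _ => (T s).le_of_opNorm_le (hM s) y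
    have := intervalIntegral.norm_integral_le_of_norm_le_const this
    rw [sub_zero] at this
    exact this.trans_eq (by ring)
  exact hJ.comp continuous_snd

lemma mem_graph_idOp {x y : E} : (x, y) ∈ (idOp : E →ₗ.[ℂ] E).graph ↔ x = y := by
  rw [LinearPMap.mem_graph_iff]
  constructor
  · rintro ⟨z, h1, h2⟩
    exact h1.symm.trans h2
  · rintro rfl
    exact ⟨⟨x, trivial⟩, rfl, rfl⟩

lemma mem_graph_mulOp {C B : E →ₗ.[ℂ] E} {x z : E} :
    (x, z) ∈ (mulOp C B).graph ↔ ∃ y, (x, y) ∈ B.graph ∧ (y, z) ∈ C.graph := by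
  simp only [LinearPMap.mem_graph_iff]
  constructor
  · rintro ⟨⟨w, hw⟩, h1, h2⟩
    obtain ⟨⟨v, hv, hvw⟩, hw1⟩ := hw
    dsimp only at h1 h2
    subst h1
    subst hvw
    exact ⟨B v, ⟨v, rfl, rfl⟩, ⟨B v, hv⟩, rfl, h2⟩
  · rintro ⟨y, ⟨v, h1, h2⟩, ⟨w, h3, h4⟩⟩
    subst h1
    subst h2
    have h3' : (w : E) = B.toFun v := h3
    have hw : B.toFun v ∈ C.domain := h3' ▸ w.2
    refine ⟨⟨v, ⟨⟨v, hw, rfl⟩, v.2⟩⟩, rfl, ?_⟩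
    rw [← h4]
    have : w = ⟨B.toFun v, hw⟩ := Subtype.ext h3
    rw [this]
    rfl

lemma mem_graph_add {C B : E →ₗ.[ℂ] E} {x z : E} :
    (x, z) ∈ (B + C).graph ↔ ∃ y y', (x, y) ∈ B.graph ∧ (x, y') ∈ C.graph ∧ y + y' = z := by
  simp only [LinearPMap.mem_graph_iff]
  constructor
  · rintro ⟨⟨w, hw⟩, h1, h2⟩
    dsimp only at h1 h2
    subst h1
    exact ⟨B ⟨w, hw.1⟩, C ⟨w, hw.2⟩, ⟨_, rfl, rfl⟩, ⟨_, rfl, rfl⟩, h2⟩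
  · rintro ⟨y, y', ⟨v, h1, h2⟩, ⟨⟨w, hw⟩, h3, h4⟩, h5⟩
    subst h1
    obtain rfl : w = v := h3
    subst h2 h4 h5
    exact ⟨⟨v, ⟨v.2, hw⟩⟩, rfl, rfl⟩

lemma mem_graph_smul {B : E →ₗ.[ℂ] E} {a : ℂ} {x z : E} :
    (x, z) ∈ (a • B).graph ↔ ∃ y, (x, y) ∈ B.graph ∧ a • y = z := by
  rw [LinearPMap.smul_graph]
  constructor
  · rintro ⟨⟨x', y⟩, h, heq⟩
    obtain ⟨rfl, rfl⟩ := Prod.mk.inj heq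
    exact ⟨y, h, rfl⟩
  · rintro ⟨y, h, rfl⟩
    exact ⟨(x, y), h, rfl⟩

/-- The graph of `B` is the image of a closed subspace `G` of some `E × Y` under a map
`(x, w) ↦ (x, L w)`. This is weaker than closedness of `B` and, unlike it, passes to sums and
products on their natural domains: `w` collects the values of the operators involved. -/
def HasClosedLift (B : E →ₗ.[ℂ] E) : Prop :=
  ∃ (Y : Type u) (_ : NormedAddCommGroup Y) (_ : NormedSpace ℂ Y) (_ : CompleteSpace Y)
    (_ : SecondCountableTopology Y) (G : Submodule ℂ (E × Y)) (L : Y →L[ℂ] E),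
    IsClosed (G : Set (E × Y)) ∧ ∀ x y, (x, y) ∈ B.graph ↔ ∃ w, (x, w) ∈ G ∧ L w = y

lemma HasClosedLift.mulOp {C B : E →ₗ.[ℂ] E} (hC : HasClosedLift C) (hB : HasClosedLift B) :
    HasClosedLift (mulOp C B) := by
  obtain ⟨Y, _, _, _, _, G, L, hG, hGL⟩ := hB
  obtain ⟨Y', _, _, _, _, G', L', hG', hGL'⟩ := hC
  let p : E × Y × Y' →L[ℂ] E × Y := (ContinuousLinearMap.fst ℂ E (Y × Y')).prod
    ((ContinuousLinearMap.fst ℂ Y Y').comp (ContinuousLinearMap.snd ℂ E (Y × Y')))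
  let p' : E × Y × Y' →L[ℂ] E × Y' :=
    (L.prodMap (ContinuousLinearMap.id ℂ Y')).comp (ContinuousLinearMap.snd ℂ E (Y × Y'))
  refine ⟨Y × Y', inferInstance, inferInstance, inferInstance, inferInstance,
    G.comap p.toLinearMap ⊓ G'.comap p'.toLinearMap,
    L'.comp (ContinuousLinearMap.snd ℂ Y Y'),
    (hG.preimage p.continuous).inter (hG'.preimage p'.continuous), fun x z => ?_⟩
  rw [mem_graph_mulOp]
  constructor
  · rintro ⟨y, h1, h2⟩
    obtain ⟨w, hw, rfl⟩ := (hGL _ _).1 h1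
    obtain ⟨w', hw', rfl⟩ := (hGL' _ _).1 h2
    exact ⟨(w, w'), ⟨hw, hw'⟩, rfl⟩
  · rintro ⟨⟨w, w'⟩, ⟨hw, hw'⟩, rfl⟩
    exact ⟨L w, (hGL _ _).2 ⟨w, hw, rfl⟩, (hGL' _ _).2 ⟨w', hw', rfl⟩⟩

lemma HasClosedLift.add {B C : E →ₗ.[ℂ] E} (hB : HasClosedLift B) (hC : HasClosedLift C) :
    HasClosedLift (B + C) := by
  obtain ⟨Y, _, _, _, _, G, L, hG, hGL⟩ := hB
  obtain ⟨Y', _, _, _, _, G', L', hG', hGL'⟩ := hC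
  let p : E × Y × Y' →L[ℂ] E × Y :=
    (ContinuousLinearMap.id ℂ E).prodMap (ContinuousLinearMap.fst ℂ Y Y')
  let p' : E × Y × Y' →L[ℂ] E × Y' :=
    (ContinuousLinearMap.id ℂ E).prodMap (ContinuousLinearMap.snd ℂ Y Y')
  refine ⟨Y × Y', inferInstance, inferInstance, inferInstance, inferInstance,
    G.comap p.toLinearMap ⊓ G'.comap p'.toLinearMap, L.coprod L',
    (hG.preimage p.continuous).inter (hG'.preimage p'.continuous), fun x z => ?_⟩
  rw [mem_graph_add]
  constructor
  · rintro ⟨y, y', h1, h2, rfl⟩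
    obtain ⟨w, hw, rfl⟩ := (hGL _ _).1 h1
    obtain ⟨w', hw', rfl⟩ := (hGL' _ _).1 h2
    exact ⟨(w, w'), ⟨hw, hw'⟩, rfl⟩
  · rintro ⟨⟨w, w'⟩, ⟨hw, hw'⟩, rfl⟩
    exact ⟨L w, L' w', (hGL _ _).2 ⟨w, hw, rfl⟩, (hGL' _ _).2 ⟨w', hw', rfl⟩, rfl⟩

lemma HasClosedLift.smul {B : E →ₗ.[ℂ] E} (hB : HasClosedLift B) (a : ℂ) :
    HasClosedLift (a • B) := by
  obtain ⟨Y, _, _, _, _, G, L, hG, hGL⟩ := hB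
  refine ⟨Y, inferInstance, inferInstance, inferInstance, inferInstance, G, a • L, hG,
    fun x z => ?_⟩
  rw [mem_graph_smul]
  constructor
  · rintro ⟨y, h1, rfl⟩
    obtain ⟨w, hw, rfl⟩ := (hGL _ _).1 h1
    exact ⟨w, hw, rfl⟩
  · rintro ⟨w, hw, rfl⟩
    exact ⟨L w, (hGL _ _).2 ⟨w, hw, rfl⟩, rfl⟩

variable [CompleteSpace E] [SecondCountableTopology E]

lemma hasClosedLift_of_isClosed_graph {B : E →ₗ.[ℂ] E} (h : IsClosed (B.graph : Set (E × E))) :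
    HasClosedLift B :=
  ⟨E, inferInstance, inferInstance, inferInstance, inferInstance, B.graph,
    ContinuousLinearMap.id ℂ E, h, fun x y => by simp⟩

lemma hasClosedLift_idOp : HasClosedLift (idOp : E →ₗ.[ℂ] E) := by
  refine hasClosedLift_of_isClosed_graph ?_
  have : ((idOp : E →ₗ.[ℂ] E).graph : Set (E × E)) = {q | q.1 = q.2} := by
    ext ⟨x, y⟩; exact mem_graph_idOp
  rw [this]
  exact isClosed_eq continuous_fst continuous_snd

lemma hasClosedLift_zero : HasClosedLift (0 : E →ₗ.[ℂ] E) := by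
  refine hasClosedLift_of_isClosed_graph ?_
  have : ((0 : E →ₗ.[ℂ] E).graph : Set (E × E)) = {q | q.2 = 0} := by
    ext ⟨x, y⟩
    rw [SetLike.mem_coe, LinearPMap.mem_graph_iff]
    constructor
    · rintro ⟨z, -, h2⟩
      exact h2.symm
    · intro h
      exact ⟨⟨x, trivial⟩, rfl, h.symm⟩
  rw [this]
  exact isClosed_eq continuous_snd continuous_const

lemma HasClosedLift.powOp {B : E →ₗ.[ℂ] E} (hB : HasClosedLift B) (k : ℕ) :
    HasClosedLift (powOp B k) := by
  induction k with
  | zero => exact hasClosedLift_idOp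
  | succ k ih => exact hB.mulOp ih

lemma hasClosedLift_monomialOp {N : ℕ} {A : Fin N → (E →ₗ.[ℂ] E)} (hA : ∀ j, HasClosedLift (A j))
    (η : Fin N →₀ ℕ) : HasClosedLift (monomialOp A η) := by
  have : ∀ l : List (E →ₗ.[ℂ] E), (∀ B ∈ l, HasClosedLift B) →
      HasClosedLift (l.foldr HigherOrderACP.mulOp idOp) := by
    intro l
    induction l with
    | nil => intro _; exact hasClosedLift_idOp
    | cons B l ih =>
      intro h
      exact (h B (by simp)).mulOp (ih fun C hC => h C (by simp [hC]))
  refine this _ fun B hB => ?_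
  obtain ⟨j, rfl⟩ := (List.mem_ofFn' _ _).1 hB
  exact (hA j).powOp _

lemma hasClosedLift_polyOp {N : ℕ} {A : Fin N → (E →ₗ.[ℂ] E)} (hA : ∀ j, HasClosedLift (A j))
    (p : MvPolynomial (Fin N) ℂ) : HasClosedLift (polyOp A p) :=
  Finset.sum_induction _ HasClosedLift (fun _ _ => HasClosedLift.add) hasClosedLift_zero
    fun η _ => (hasClosedLift_monomialOp hA η).smul _

lemma hasClosedLift_of_isGroupGenerator {B : E →ₗ.[ℂ] E} {T : ℝ → E →L[ℂ] E}
    (hT : IsBoundedC0Group T) (hB : IsGroupGenerator (Complex.I • B) T) : HasClosedLift B := by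
  have h := (hasClosedLift_of_isClosed_graph (hB.isClosed_graph hT)).smul Complex.I⁻¹
  rwa [smul_smul, inv_mul_cancel₀ Complex.I_ne_zero, one_smul] at h

end ClosedGraph

/-! ### From limits of exponential polynomials to strong solutions -/

section Condensation

variable {ι X : Type*} [NormedAddCommGroup X]

/-- By second countability, discarding countably many frequencies makes all points
condensation points. -/
lemma exists_isCondensed [SecondCountableTopology X] (lam : ι → ℝ) (g : ι → X) :
    ∃ J : Set ι, (lam '' Jᶜ).Countable ∧ IsCondensed (fun i : J => lam i) (fun i : J => g i) := by
  set S : Set (ℝ × X) → Set ℝ := fun O => lam '' {j | (lam j, g j) ∈ O} with hS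
  set 𝓑 := TopologicalSpace.countableBasis (ℝ × X) with h𝓑
  set J : Set ι := {i | ∀ O ∈ 𝓑, (lam i, g i) ∈ O → ¬ (S O).Countable} with hJ
  have hJc : (lam '' Jᶜ).Countable := by
    refine Set.Countable.mono (s₂ := ⋃ O ∈ {O ∈ 𝓑 | (S O).Countable}, S O) ?_ ?_
    · rintro _ ⟨i, hi, rfl⟩
      simp only [hJ, mem_compl_iff, mem_ofPred_eq, not_forall, not_not] at hi
      obtain ⟨O, hO, hiO, hc⟩ := hi
      exact mem_biUnion (x := O) ⟨hO, hc⟩ ⟨i, hiO, rfl⟩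
    · exact Set.Countable.biUnion
        ((TopologicalSpace.countable_countableBasis _).mono fun O hO => hO.1) fun O hO => hO.2
  refine ⟨J, hJc, ?_⟩
  rintro ⟨i, hi⟩ ε hε C hC
  obtain ⟨O, hO, hiO, hsub⟩ := (TopologicalSpace.isBasis_countableBasis (ℝ × X)).mem_nhds_iff.1
    (Metric.ball_mem_nhds (lam i, g i) hε)
  have hunc : ¬ (S O \ (C ∪ lam '' Jᶜ)).Countable := fun h =>
    hi O hO hiO (((h.union (hC.union hJc))).mono fun x hx => by
      by_cases hx' : x ∈ C ∪ lam '' Jᶜ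
      · exact Or.inr hx'
      · exact Or.inl ⟨hx, hx'⟩)
  obtain ⟨_, ⟨j, hj, rfl⟩, hj'⟩ : (S O \ (C ∪ lam '' Jᶜ)).Nonempty := by
    by_contra h
    rw [not_nonempty_iff_eq_empty] at h
    exact hunc (h ▸ countable_empty)
  rw [mem_union, not_or] at hj'
  have hball := hsub hj
  rw [Metric.mem_ball, Prod.dist_eq, max_lt_iff] at hball
  refine ⟨⟨j, by_contra fun h => hj'.2 ⟨j, h, rfl⟩⟩, hball.1, ?_, hj'.1⟩
  rw [← dist_eq_norm]; exact hball.2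

end Condensation

section Derivatives

variable {ι X Z : Type*} [NormedAddCommGroup X] [NormedSpace ℂ X] [NormedAddCommGroup Z]
  [NormedSpace ℂ Z] {lam : ι → ℝ} {g : ι → X}

lemma hasDerivAt_trigPoly {π Φ : X →L[ℂ] Z}
    (h : ∀ i, Φ (g i) = (Complex.I * (lam i : ℂ)) • π (g i)) (c : ι →₀ ℂ) (t : ℝ) :
    HasDerivAt (fun t => π (trigPoly lam g t c)) (Φ (trigPoly lam g t c)) t := by
  simp only [trigPoly_apply, map_sum, map_smul, h]
  refine HasDerivAt.fun_sum fun i _ => HasDerivAt.const_smul (c i) ?_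
  have := (hasDerivAt_phase (lam i) t).smul_const (π (g i))
  rwa [mul_comm, mul_smul] at this

lemma hasDerivAt_limit {π Φ : X →L[ℂ] Z}
    (h : ∀ i, Φ (g i) = (Complex.I * (lam i : ℂ)) • π (g i)) {c : ℕ → ι →₀ ℂ} {U : ℝ → X}
    (hU : TendstoLocallyUniformly (fun k t => trigPoly lam g t (c k)) U atTop) (t : ℝ) :
    HasDerivAt (fun t => π (U t)) (Φ (U t)) t := by
  refine hasDerivAt_of_tendstoLocallyUniformlyOn (l := atTop) (s := univ)
    (f := fun k t => π (trigPoly lam g t (c k))) (f' := fun k t => Φ (trigPoly lam g t (c k)))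
    (g' := fun t => Φ (U t)) isOpen_univ ?_ (Eventually.of_forall fun k t _ =>
      hasDerivAt_trigPoly h (c k) t) (fun t _ => ?_) (mem_univ t)
  · rw [tendstoLocallyUniformlyOn_univ]
    exact Φ.uniformContinuous.comp_tendstoLocallyUniformly hU
  · exact (π.continuous.tendsto _).comp
      ((tendstoLocallyUniformlyOn_univ.2 hU).tendsto_at (mem_univ t))

/-- A chain of functions, each the derivative of the preceding one, consists of the iterated
derivatives of the first. -/
lemma contDiff_of_hasDerivAt_chain {F : Type*} [NormedAddCommGroup F] [NormedSpace ℝ F]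
    {v : ℕ → ℝ → F} {n : ℕ} (h : ∀ k < n, ∀ t, HasDerivAt (v k) (v (k + 1) t) t)
    (hc : Continuous (v n)) :
    ContDiff ℝ n (v 0) ∧ ∀ k ≤ n, iteratedDeriv k (v 0) = v k := by
  have hit : ∀ k ≤ n, iteratedDeriv k (v 0) = v k := by
    intro k
    induction k with
    | zero => intro _; exact iteratedDeriv_zero
    | succ k ih =>
      intro hk
      rw [iteratedDeriv_succ, ih (by omega)]
      exact funext fun t => (h k (by omega) t).deriv
  refine ⟨contDiff_iff_iteratedDeriv (n := (n : ℕ∞)) |>.2 ⟨fun m hm => ?_, fun m hm => ?_⟩, hit⟩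
  · have hm' : m ≤ n := by exact_mod_cast hm
    rw [hit m hm']
    rcases hm'.eq_or_lt with rfl | hlt
    · exact hc
    · exact continuous_iff_continuousAt.2 fun t => (h m hlt t).continuousAt
  · have hm' : m < n := by exact_mod_cast hm
    rw [hit m hm'.le]
    exact fun t => (h m hm' t).differentiableAt

end Derivatives

lemma subset_closure_diff_countable {I C : Set ℝ} (hI : I.OrdConnected) (hI' : I.Nontrivial)
    (hC : C.Countable) : I ⊆ closure (I \ C) := by
  obtain ⟨a, ha, b, hb, hab⟩ := hI'.exists_lt
  have hint : (interior I).Nonempty := by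
    refine (nonempty_Ioo.2 hab).mono (interior_maximal ?_ isOpen_Ioo)
    exact Ioo_subset_Icc_self.trans (hI.out ha hb)
  have h1 := (hI.convex (𝕜 := ℝ)).closure_interior_eq_closure_of_nonempty_interior hint
  have h2 := (hC.dense_compl ℝ).open_subset_closure_inter (isOpen_interior (s := I))
  calc I ⊆ closure I := subset_closure
    _ = closure (interior I) := h1.symm
    _ ⊆ closure (interior I ∩ Cᶜ) := closure_minimal h2 isClosed_closure
    _ ⊆ closure (I \ C) := closure_mono (inter_subset_inter_left _ interior_subset)

section Companion

variable {E : Type u} [NormedAddCommGroup E] [NormedSpace ℂ E] {n : ℕ}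

/-- In coordinates, with the values `v l = A_l x_l` named. -/
lemma exists_of_mem_graph_companionOp {A : Fin n → (E →ₗ.[ℂ] E)} {x y : Fin n → E}
    (h : (x, y) ∈ (companionOp A).graph) :
    ∃ v : Fin n → E, (∀ l, (x l, v l) ∈ (A l).graph) ∧
      ∀ i : Fin n, y i = if h : (i : ℕ) + 1 < n then x ⟨i + 1, h⟩ else -∑ l, v l := by
  rw [LinearPMap.mem_graph_iff] at h
  obtain ⟨⟨z, hz⟩, h1, h2⟩ := h
  dsimp only at h1 h2
  subst h1
  refine ⟨fun l => A l ⟨z l, (Submodule.mem_iInf _).1 hz l⟩, fun l => ?_, fun i => ?_⟩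
  · exact (A l).mem_graph ⟨z l, (Submodule.mem_iInf _).1 hz l⟩
  · rw [← h2]
    by_cases hi : (i : ℕ) + 1 < n
    · rw [dif_pos hi]
      exact congrArg (fun f : ↥(⨅ l, (A l).domain.comap
        (LinearMap.proj l : (Fin n → E) →ₗ[ℂ] E)) →ₗ[ℂ] E => f ⟨z, hz⟩) (dif_pos hi)
    · rw [dif_neg hi]
      refine (congrArg (fun f : ↥(⨅ l, (A l).domain.comap
        (LinearMap.proj l : (Fin n → E) →ₗ[ℂ] E)) →ₗ[ℂ] E => f ⟨z, hz⟩) (dif_neg hi)).trans ?_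
      dsimp only
      rw [LinearMap.neg_apply, LinearMap.sum_apply]
      rfl

/-- Frequent hypercyclicity for operators with closed lifts. The exponential polynomials of
`IsCondensed.exists_frequently_visiting` are formed in the product of `E ^ n` and the spaces `Y l`,
whose coordinates make the graphs of the `A l` closed, so that their locally uniform limits are
strong solutions. -/
theorem isFreqHypercyclicACP_of_closedLift [CompleteSpace E] [SecondCountableTopology E]
    (hn : 0 < n) (A : Fin n → (E →ₗ.[ℂ] E)) (Y : Fin n → Type u)
    [∀ l, NormedAddCommGroup (Y l)] [∀ l, NormedSpace ℂ (Y l)] [∀ l, CompleteSpace (Y l)]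
    [∀ l, SecondCountableTopology (Y l)] (G : ∀ l, Submodule ℂ (E × Y l))
    (L : ∀ l, Y l →L[ℂ] E) (hG : ∀ l, IsClosed (G l : Set (E × Y l)))
    (hGL : ∀ l x y, (x, y) ∈ (A l).graph ↔ ∃ w, (x, w) ∈ G l ∧ L l w = y)
    {Γ : Type*} (I : Γ → Set ℝ) (F : Γ → ℝ → (Fin n → E))
    (hI : ∀ j, (I j).OrdConnected ∧ (I j).Nontrivial)
    (hF : ∀ j, ContinuousOn (F j) (I j))
    (hEig : ∀ j, ∀ t ∈ I j,
      (F j t, (Complex.I * (t : ℂ)) • F j t) ∈ (companionOp A).graph)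
    (Et : Submodule ℂ (Fin n → E))
    (hEt : Et = (Submodule.span ℂ {x | ∃ j, ∃ t ∈ I j, F j t = x}).topologicalClosure) :
    IsFreqHypercyclicACP A Set.univ Et (fun i => Et.map (LinearMap.proj (i : Fin n))) := by
  -- the eigenvectors, together with lifts of the values of the operators on them
  let ι := {q : Γ × ℝ // q.2 ∈ I q.1}
  have hlift : ∀ q : ι, ∃ w : ∀ l, Y l, (∀ l, (F q.1.1 q.1.2 l, w l) ∈ G l) ∧
      ∀ i : Fin n, ((Complex.I * (q.1.2 : ℂ)) • F q.1.1 q.1.2) i =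
        if h : (i : ℕ) + 1 < n then F q.1.1 q.1.2 ⟨i + 1, h⟩ else -∑ l, L l (w l) := by
    intro q
    obtain ⟨v, hv, hy⟩ := exists_of_mem_graph_companionOp (hEig q.1.1 q.1.2 q.2)
    choose w hw hLw using fun l => (hGL l _ _).1 (hv l)
    exact ⟨w, hw, fun i => by simpa only [hLw] using hy i⟩
  choose w hwG hw using hlift
  let lam₀ : ι → ℝ := fun q => q.1.2
  let g₀ : ι → (Fin n → E) × (∀ l, Y l) := fun q => (F q.1.1 q.1.2, w q)
  obtain ⟨J, hJ, hcond⟩ := exists_isCondensed lam₀ g₀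
  set lam : J → ℝ := fun i => lam₀ i with hlam
  set g : J → (Fin n → E) × (∀ l, Y l) := fun i => g₀ i with hg
  obtain ⟨c, U, hU, hvisit⟩ := hcond.exists_frequently_visiting
  let π : (Fin n → E) × (∀ l, Y l) →L[ℂ] (Fin n → E) := ContinuousLinearMap.fst ℂ _ _
  let Φ : (Fin n → E) × (∀ l, Y l) →L[ℂ] (Fin n → E) := ContinuousLinearMap.pi fun i =>
    if h : (i : ℕ) + 1 < n then
      (ContinuousLinearMap.proj (R := ℂ) (φ := fun _ : Fin n => E) ⟨i + 1, h⟩).comp π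
    else -∑ l, (L l).comp ((ContinuousLinearMap.proj (R := ℂ) (φ := Y) l).comp
      (ContinuousLinearMap.snd ℂ (Fin n → E) (∀ l, Y l)))
  have hΦ : ∀ (z : (Fin n → E) × (∀ l, Y l)) (i : Fin n),
      Φ z i = if h : (i : ℕ) + 1 < n then z.1 ⟨i + 1, h⟩ else -∑ l, L l (z.2 l) := by
    intro z i
    simp only [Φ, ContinuousLinearMap.pi_apply]
    split_ifs
    · rfl
    · simp
  have hderiv : ∀ t, HasDerivAt (fun t => (U t).1) (Φ (U t)) t := fun t =>
    hasDerivAt_limit (π := π) (Φ := Φ) (fun q => funext fun i => by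
      rw [hΦ]; exact (hw q.1 i).symm) hU t
  have hUlim : ∀ t, Tendsto (fun k => trigPoly lam g t (c k)) atTop (𝓝 (U t)) := fun t =>
    (tendstoLocallyUniformlyOn_univ.2 hU).tendsto_at (mem_univ t)
  -- the limit stays in the closed subspace that contains the lifted eigenvectors
  let M : Submodule ℂ ((Fin n → E) × (∀ l, Y l)) := (⨅ l, (G l).comap
    (((LinearMap.proj l : (Fin n → E) →ₗ[ℂ] E)).prodMap
      (LinearMap.proj l : (∀ l, Y l) →ₗ[ℂ] Y l))) ⊓
      Et.comap (LinearMap.fst ℂ (Fin n → E) (∀ l, Y l))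
  have hMmem : ∀ z : (Fin n → E) × (∀ l, Y l), z ∈ M ↔
      (∀ l, (z.1 l, z.2 l) ∈ G l) ∧ z.1 ∈ Et := fun z => by
    rw [Submodule.mem_inf, Submodule.mem_iInf]; rfl
  have hMclosed : IsClosed (M : Set ((Fin n → E) × (∀ l, Y l))) := by
    have : (M : Set ((Fin n → E) × (∀ l, Y l))) =
        (⋂ l, {z : (Fin n → E) × (∀ l, Y l) | (z.1 l, z.2 l) ∈ G l}) ∩ {z | z.1 ∈ Et} := by
      ext z; simp [hMmem]
    rw [this]
    refine (isClosed_iInter fun l => (hG l).preimage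
      (f := fun z : (Fin n → E) × (∀ l, Y l) => (z.1 l, z.2 l)) (by fun_prop)).inter ?_
    rw [hEt]
    exact (Submodule.isClosed_topologicalClosure _).preimage continuous_fst
  have hgM : Submodule.span ℂ (range g) ≤ M := by
    rw [Submodule.span_le]
    rintro _ ⟨q, rfl⟩
    refine (hMmem _).2 ⟨hwG q.1, ?_⟩
    rw [hEt]
    exact Submodule.le_topologicalClosure _ (Submodule.subset_span ⟨_, _, q.1.2, rfl⟩)
  have hUM : ∀ t, U t ∈ M := fun t => hMclosed.mem_of_tendsto (hUlim t)
    (Eventually.of_forall fun k => hgM (trigPoly_mem_span _ _))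
  have hUcont : Continuous U := hU.continuous (Frequently.of_forall fun k => continuous_trigPoly _)
  -- the solution and its derivatives
  let v : ℕ → ℝ → E := fun k t =>
    if h : k < n then (U t).1 ⟨k, h⟩ else -∑ l, L l ((U t).2 l)
  have hv : ∀ k < n, ∀ t, HasDerivAt (v k) (v (k + 1) t) t := by
    intro k hk t
    have h1 := hasDerivAt_pi.1 (hderiv t) ⟨k, hk⟩
    rw [hΦ] at h1
    simpa only [v, dif_pos hk] using h1
  have hvn : Continuous (v n) := by
    simp only [v, lt_irrefl, dite_false]
    fun_prop
  obtain ⟨hsmooth, hiter⟩ := contDiff_of_hasDerivAt_chain hv hvn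
  have hhalf : ∀ k ≤ n, ∀ t ∈ Ici (0 : ℝ), halfLineDeriv k (v 0) t = v k t := by
    intro k hk t ht
    rw [halfLineDeriv, iteratedDerivWithin_eq_iteratedDeriv (uniqueDiffOn_Ici 0)
      ((hsmooth.of_le (by exact_mod_cast hk)).contDiffAt) ht, hiter k hk]
  have hhalf' : ∀ i : Fin n, ∀ t ∈ Ici (0 : ℝ), halfLineDeriv (i : ℕ) (v 0) t = (U t).1 i :=
    fun i t ht => by rw [hhalf i i.2.le t ht]; simp [v]
  refine ⟨⟨⟨0, hn⟩, trivial⟩, (U 0).1, v 0, ((hMmem _).1 (hUM 0)).2,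
    ⟨hsmooth.contDiffOn, ⟨fun i t => L i ((U t).2 i), fun i => ?_, fun i t ht => ?_,
      fun t ht => ?_⟩, fun k => hhalf' k 0 self_mem_Ici⟩, fun V hV hyV => ?_⟩
  · exact Continuous.continuousOn (by fun_prop)
  · rw [hhalf' i t ht]
    exact (hGL i _ _).2 ⟨_, ((hMmem _).1 (hUM t)).1 i, rfl⟩
  · rw [hhalf n le_rfl t ht]
    simp [v]
  · obtain ⟨y, hy, hyV⟩ := hyV
    set O : Set (Fin n → E) := ⋂ i : (univ : Set (Fin n)), {z | z i ∈ V i} with hO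
    have hOopen : IsOpen O := isOpen_iInter_of_finite fun i =>
      IsOpen.preimage (by fun_prop : Continuous fun z : Fin n → E => z i) (hV i)
    have hyO : y ∈ O := mem_iInter.2 fun i => (hyV i).1
    -- discarding countably many frequencies does not change the closed span of the eigenvectors
    have hEtle : Et ≤ ((Submodule.span ℂ (range g)).map π.toLinearMap).topologicalClosure := by
      rw [hEt]
      refine Submodule.topologicalClosure_minimal _ (Submodule.span_le.2 ?_)
        (Submodule.isClosed_topologicalClosure _)
      rintro _ ⟨j, t, ht, rfl⟩
      have h1 := subset_closure_diff_countable (hI j).1 (hI j).2 hJ ht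
      have h2 : F j t ∈ closure (F j '' (I j \ (lam₀ '' Jᶜ))) :=
        ((hF j t ht).mono sdiff_subset).mem_closure_image h1
      refine closure_mono ?_ h2
      rintro _ ⟨t', ⟨ht', hnot⟩, rfl⟩
      have hmem : (⟨(j, t'), ht'⟩ : ι) ∈ J := by_contra fun h => hnot ⟨_, h, rfl⟩
      exact ⟨g ⟨_, hmem⟩, Submodule.subset_span ⟨_, rfl⟩, rfl⟩
    obtain ⟨_, hzO, ⟨z, hz, rfl⟩⟩ := mem_closure_iff.1 (hEtle hy) O hOopen hyO
    obtain ⟨ε, hε, hball⟩ := Metric.isOpen_iff.1 (hOopen.preimage continuous_fst) z hzO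
    refine (hvisit z hz ε hε).trans_le (lowerDensity_mono ?_)
    rintro t ⟨ht, htz⟩
    have hUO : (U t).1 ∈ O := hball (by rw [Metric.mem_ball, dist_eq_norm]; exact htz)
    refine ⟨ht, fun i => ?_⟩
    rw [hhalf' i t ht]
    exact ⟨mem_iInter.1 hUO i, (U t).1, ((hMmem _).1 (hUM t)).2, rfl⟩

end Companion

end HigherOrderACP

end

theorem theorem2p1
    {E : Type*} [NormedAddCommGroup E] [NormedSpace ℂ E] [CompleteSpace E]
    [TopologicalSpace.SeparableSpace E] (hE : ¬ FiniteDimensional ℂ E)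
    {N n : ℕ} (hN : 0 < N) (hn : 0 < n)
    -- `i A_1, …, i A_N` are commuting generators of bounded `C₀`-groups
    (A : Fin N → (E →ₗ.[ℂ] E)) (T : Fin N → ℝ → E →L[ℂ] E)
    (hT : ∀ j, HigherOrderACP.IsBoundedC0Group (T j))
    (hA : ∀ j, HigherOrderACP.IsGroupGenerator (Complex.I • A j) (T j))
    (hcomm : ∀ j k s t, Commute (T j s) (T k t))
    -- the polynomials `p_0, …, p_{n-1}`
    (p : Fin n → MvPolynomial (Fin N) ℂ)
    {Γ : Type*} (I : Γ → Set ℝ) (F : Γ → ℝ → (Fin n → E))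
    (hI : ∀ j, (I j).OrdConnected ∧ (I j).Nontrivial)
    (hF : ∀ j, ContDiffOn ℝ 2 (F j) (I j))
    (hEig : ∀ j, ∀ t ∈ I j, (F j t, (Complex.I * (t : ℂ)) • F j t) ∈
      (HigherOrderACP.companionOp fun l => HigherOrderACP.polyOp A (p l)).graph)
    (Et : Submodule ℂ (Fin n → E))
    (hEt : Et = (Submodule.span ℂ {x | ∃ j, ∃ t ∈ I j, F j t = x}).topologicalClosure) :
    HigherOrderACP.IsFreqHypercyclicACP (fun l => HigherOrderACP.polyOp A (p l)) Set.univ Et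
      (fun i => Et.map (LinearMap.proj (i : Fin n))) := by
  have : SecondCountableTopology E := UniformSpace.secondCountable_of_separable E
  have hlift := fun l : Fin n => HigherOrderACP.hasClosedLift_polyOp
    (fun j => HigherOrderACP.hasClosedLift_of_isGroupGenerator (hT j) (hA j)) (p l)
  choose Y _ _ _ _ G L hG hGL using hlift
  exact HigherOrderACP.isFreqHypercyclicACP_of_closedLift hn _ Y G L hG hGL I F hI
    (fun j => (hF j).continuousOn) hEig Et hEt
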